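/- **Setting.** Let $M,N,L,M_p,N_p$ be integers with $2L\le M$, $2L\le N$, $1\le M_p\le M$, $1\le N_p\le N$. Write $\mathbf f_K(\phi)=[1,e^{-i2\pi\phi},\dots,e^{-i2\pi\phi(K-1)}]^T$. Let $$\mathbf H=\sum_{l=0}^{L-1}c_l\,\mathbf f_M(\theta_l)\mathbf f_N^H(\tau_l)\in\mathbb C^{M\times N},\qquad c_l\in\mathbb C,\ \theta_l,\tau_l\in[0,1].$$ Let $\mathcal M_p\subseteq\{0,\dots,M-1\}$ and $\mathcal N_p\subseteq\{0,\dots,N-1\}$ be independent, uniformly distributed subsets of cardinalities $M_p$ and $N_p$. Let $\mathbf S_{\mathcal M_p}$, $\mathbf S_{\mathcal N_p}$ be the $0/1$ matrices that extract the coordinates in these sets. Put $\mathbf H_1=\mathbf H\mathbf S_{\mathcal N_p}^T\in\mathbb C^{M\times N_p}$. One observes $\mathbf Y=\mathbf S_{\mathcal M_p}\mathbf H\mathbf S_{\mathcal N_p}^T+\mathbf Z$, where $\mathbf Z$ is independent of the sets and has i.i.d. circularly symmetric complex Gaussian entries of mean $0$ and variance $\sigma^2$. **First step.** Let $\hat{\mathbf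 H}_1$ be an estimator of $\mathbf H_1$ from $\mathbf Y$ (and $\mathcal M_p,\mathcal N_p$) that treats the columns of $\mathbf H_1$ as multiple measurement vectors. That is, for every fixed $\mathcal N_p$ and every matrix $\mathbf X=\sum_{l=0}^{L-1}\mathbf f_M(\theta'_l)\mathbf b_l^H$ with $\theta'_l\in[0,1]$ and arbitrary $\mathbf b_l\in\mathbb C^{N_p}$, it is unbiased for $\mathbf X$ when the observation is $\mathbf S_{\mathcal M_p}\mathbf X+\mathbf Z$ (expectation over $\mathbf Z$ and $\mathcal M_p$). Let $v=\frac1{MN_p}\mathbb E\|\hat{\mathbf H}_1-\mathbf H_1\|^2<\infty$ be its per-element mean squared error at $\mathbf H$ (Frobenius norm; expectation over $\mathbf Z,\mathcal M_p,\mathcal N_p$). **Second step.** Assume that the error of the first step consists of i.i.d. zero-mean Gaussian elements: the second step operates on $\hat{\mathbf H}_1=\mathbf H_1+\mathbf E_1$, where $\mathbf E_1$ is independent of $\mathcal N_p$ and has i.i.d. circularly symmetric complex Gaussian entries of mean $0$ and variance $v$. Let $\hat{\mathbf H}$ be an estimator of $\mathbf H$ from $\hat{\mathbf H}_1$ (and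 $\mathcal N_p$) that treats the rows of $\mathbf H$ as multiple measurement vectors. That is, for every matrix $\mathbf X=\sum_{l=0}^{L-1}\mathbf b_l\mathbf f_N^H(\tau'_l)$ with $\tau'_l\in[0,1]$ and arbitrary $\mathbf b_l\in\mathbb C^{M}$, it is unbiased for $\mathbf X$ when it is applied to $\mathbf X\mathbf S_{\mathcal N_p}^T+\mathbf E_1$ (expectation over $\mathbf E_1$ and $\mathcal N_p$). **Claim.** The per-element mean squared error at $\mathbf H$ satisfies $$\frac1{MN}\mathbb E\|\hat{\mathbf H}-\mathbf H\|^2\ \ge\ \frac{L^2\sigma^2(1+2N_p)(1+2M)}{4MM_pN_p^2},$$ where the expectation is over $\mathbf E_1$ and $\mathcal N_p$. The right-hand side is approximately $\frac{L^2\sigma^2}{M_pN_p}$ for large $N_p$ and $M_p$: for every $\varepsilon>0$ there is $K$, depending only on $\varepsilon$, such that for all $L$, $\sigma$, all $N_p\ge K$ and all $M\ge M_p\ge K$ the two expressions differ by at most $\varepsilon\,\frac{L^2\sigma^2}{M_pN_p}$. -/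

import Mathlib

open MeasureTheory ProbabilityTheory
open scoped NNReal ENNReal Matrix

noncomputable section

/-- Matrices carry the product (Borel) σ-algebra of their entries. -/
instance complexMatrixMeasurableSpace {m n : Type*} : MeasurableSpace (Matrix m n ℂ) :=
  inferInstanceAs (MeasurableSpace (m → n → ℂ))

/-- The complex exponential sequence `[1, e^{-i2πφ}, …, e^{-i2πφ(K-1)}]ᵀ` of length `K`. -/
def expSeq (K : ℕ) (φ : ℝ) : Fin K → ℂ :=
  fun k => Complex.exp (-(Complex.I * 2 * Real.pi * φ * (k : ℕ)))

/-- The channel matrix `H = ∑ l, c l • f_M(θ l) f_N(τ l)ᴴ` of `L` propagation paths. -/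
def channel (M N : ℕ) {L : ℕ} (c : Fin L → ℂ) (θ τ : Fin L → ℝ) :
    Matrix (Fin M) (Fin N) ℂ :=
  ∑ l, c l • Matrix.vecMulVec (expSeq M (θ l)) (star (expSeq N (τ l)))

/-- The `M × K` matrices whose columns are multiple measurement vectors of one harmonic sequence
with `L` frequencies: `∑ l, f_M(θ l) (b l)ᴴ` with arbitrary coefficient vectors `b l ∈ ℂ^K`. -/
def columnMMV (M K L : ℕ) : Set (Matrix (Fin M) (Fin K) ℂ) :=
  {X | ∃ (θ : Fin L → ℝ) (b : Fin L → Fin K → ℂ), (∀ l, θ l ∈ Set.Icc (0 : ℝ) 1) ∧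
    X = ∑ l, Matrix.vecMulVec (expSeq M (θ l)) (star (b l))}

/-- The `M × N` matrices whose rows are multiple measurement vectors of one harmonic sequence
with `L` frequencies: `∑ l, (b l) f_N(τ l)ᴴ` with arbitrary coefficient vectors `b l ∈ ℂ^M`. -/
def rowMMV (M N L : ℕ) : Set (Matrix (Fin M) (Fin N) ℂ) :=
  {X | ∃ (τ : Fin L → ℝ) (b : Fin L → Fin M → ℂ), (∀ l, τ l ∈ Set.Icc (0 : ℝ) 1) ∧
    X = ∑ l, Matrix.vecMulVec (b l) (star (expSeq N (τ l)))}

/-- The subsets of `{0, …, K-1}` with exactly `k` elements. -/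
abbrev SampleSet (K k : ℕ) : Type := {s : Finset (Fin K) // s.card = k}

/-- The `k × K` downsampling matrix with entries in `{0, 1}` that extracts, in increasing order,
the coordinates belonging to the set `s`. -/
def downsample {K k : ℕ} (s : SampleSet K k) : Matrix (Fin k) (Fin K) ℂ :=
  Matrix.of fun i j => if s.1.orderEmbOfFin s.2 i = j then 1 else 0

/-- The law of a (circularly symmetric) complex Gaussian variable of zero mean and variance `v`:
real and imaginary parts are independent real Gaussians of zero mean and variance `v / 2`. -/
def complexGaussian (v : ℝ≥0) : Measure ℂ :=
  ((gaussianReal 0 (v / 2)).prod (gaussianReal 0 (v / 2))).map Complex.measurableEquivRealProd.symm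

/-- The law of an `m × n` matrix with i.i.d. complex Gaussian entries of zero mean and
variance `v`. -/
def gaussianMatrix (m n : ℕ) (v : ℝ≥0) : Measure (Matrix (Fin m) (Fin n) ℂ) :=
  Measure.pi fun _ : Fin m => Measure.pi fun _ : Fin n => complexGaussian v

/-- The squared Frobenius norm. -/
def frobSq {m n : ℕ} (X : Matrix (Fin m) (Fin n) ℂ) : ℝ := ∑ i, ∑ j, ‖X i j‖ ^ 2

/-- Unbiasedness of a first-step estimator, which maps the antenna set `A`, the pilot set `P` and
the observation `Y = S_A X + Z` to an estimate of `X = H S_Pᵀ`, and which treats the columns of `X`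
as multiple measurement vectors. For every pilot set `P` and every `X` of that form the estimate
has mean `X`, where the noise `Z` is i.i.d. complex Gaussian of variance `σ²` and `A` is uniformly
distributed and independent of `Z`. -/
def FirstStepUnbiased {M N Mp Np : ℕ} (L : ℕ) (σ : ℝ)
    (est : SampleSet M Mp → SampleSet N Np → Matrix (Fin Mp) (Fin Np) ℂ →
      Matrix (Fin M) (Fin Np) ℂ) : Prop :=
  ∀ P : SampleSet N Np, ∀ X ∈ columnMMV M Np L, ∀ (i : Fin M) (j : Fin Np),
    (∀ A : SampleSet M Mp, Integrable (fun Z => est A P (downsample A * X + Z) i j)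
      (gaussianMatrix Mp Np (σ ^ 2).toNNReal)) ∧
    (Fintype.card (SampleSet M Mp) : ℂ)⁻¹ * ∑ A : SampleSet M Mp,
      ∫ Z, est A P (downsample A * X + Z) i j ∂(gaussianMatrix Mp Np (σ ^ 2).toNNReal) = X i j

/-- The per-element mean squared error `E‖Ĥ₁ - H₁‖² / (M N_p)` of a first-step estimator for the
channel `H`, where `H₁ = H S_Pᵀ`, the observation is `Y = S_A H S_Pᵀ + Z`, and the expectation is
over the noise `Z` and the independent, uniformly distributed sets `A` and `P`. -/
def firstStepMSE {M N Mp Np : ℕ} (σ : ℝ)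
    (est : SampleSet M Mp → SampleSet N Np → Matrix (Fin Mp) (Fin Np) ℂ →
      Matrix (Fin M) (Fin Np) ℂ) (H : Matrix (Fin M) (Fin N) ℂ) : ℝ≥0∞ :=
  ((M : ℝ≥0∞) * Np)⁻¹ * ((Fintype.card (SampleSet N Np) : ℝ≥0∞)⁻¹ *
    ∑ P : SampleSet N Np, ((Fintype.card (SampleSet M Mp) : ℝ≥0∞)⁻¹ * ∑ A : SampleSet M Mp,
      ∫⁻ Z, ENNReal.ofReal (frobSq
        (est A P (downsample A * H * (downsample P)ᵀ + Z) - H * (downsample P)ᵀ))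
        ∂(gaussianMatrix Mp Np (σ ^ 2).toNNReal)))

/-- Unbiasedness of a second-step estimator, which maps the pilot set `P` and the first-step
estimate `Ĥ₁ = H S_Pᵀ + E` to an estimate of `H`, and which treats the rows of `H` as multiple
measurement vectors. For every `H` of that form the estimate has mean `H`, where the error `E` is
i.i.d. complex Gaussian of variance `v` and `P` is uniformly distributed and independent
of `E`. -/
def SecondStepUnbiased {M N Np : ℕ} (L : ℕ) (v : ℝ≥0)
    (est : SampleSet N Np → Matrix (Fin M) (Fin Np) ℂ → Matrix (Fin M) (Fin N) ℂ) : Prop :=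
  ∀ H ∈ rowMMV M N L, ∀ (i : Fin M) (j : Fin N),
    (∀ P : SampleSet N Np, Integrable (fun E => est P (H * (downsample P)ᵀ + E) i j)
      (gaussianMatrix M Np v)) ∧
    (Fintype.card (SampleSet N Np) : ℂ)⁻¹ * ∑ P : SampleSet N Np,
      ∫ E, est P (H * (downsample P)ᵀ + E) i j ∂(gaussianMatrix M Np v) = H i j

/-- The per-element mean squared error `E‖Ĥ - H‖² / (M N)` of a second-step estimator for the
channel `H`, when the first-step error is i.i.d. complex Gaussian of variance `v`. -/
def secondStepMSE {M N Np : ℕ} (v : ℝ≥0)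
    (est : SampleSet N Np → Matrix (Fin M) (Fin Np) ℂ → Matrix (Fin M) (Fin N) ℂ)
    (H : Matrix (Fin M) (Fin N) ℂ) : ℝ≥0∞ :=
  ((M : ℝ≥0∞) * N)⁻¹ * ((Fintype.card (SampleSet N Np) : ℝ≥0∞)⁻¹ *
    ∑ P : SampleSet N Np,
      ∫⁻ E, ENNReal.ofReal (frobSq (est P (H * (downsample P)ᵀ + E) - H))
        ∂(gaussianMatrix M Np v))

/-- `L² σ² (1 + 2 N_p) (1 + 2 M) / (4 M M_p N_p²)`. -/
def mmvBound (L M Mp Np : ℕ) (σ : ℝ) : ℝ :=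
  (L : ℝ) ^ 2 * σ ^ 2 * (1 + 2 * Np) * (1 + 2 * M) / (4 * M * Mp * (Np : ℝ) ^ 2)

/-- `L² σ² / (M_p N_p)`. -/
def mmvApprox (L Mp Np : ℕ) (σ : ℝ) : ℝ :=
  (L : ℝ) ^ 2 * σ ^ 2 / (Mp * Np)

end

/-! Both steps are instances of one Cramér–Rao inequality, `cramerRao_random_sampling`. For noise of
variance `v`, a translation in direction `W` has Fisher information `2/v * frobSq W`. Random
sampling keeps on average a fraction `ρ` of the squared norm, so every unit direction tangent to the
model carries average information `2ρ/v`. An unbiased estimator therefore has mean squared error at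
least `v/(2ρ)` along each of them. Summing over an orthonormal basis of the tangent span multiplies
this by its real dimension.

That dimension is at least `L * (1 + 2 * K)`: there are `L` real frequencies and `L * K` complex
amplitudes. At a regular point the parametrization has injective differential, by nonsingularity of
a confluent Vandermonde system (`eq_zero_of_sum_confluent_pow_eq_zero`; this is where `2 * L ≤ M`
enters). At a point with a vanishing amplitude or coinciding frequencies, the tangent span contains
`M` independent exponentials with arbitrary amplitudes, which is more than enough.

With `ρ = Mp/M` the first step gives a lower bound for `v`. With `ρ = Np/N` the second step gives a
bound linear in `v`, and substitution yields the claim.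

No regularity of the estimators is assumed beyond the integrability in unbiasedness. The mean is
differentiated through the likelihood ratio, whose linearization error in `L²` is explicit
(`abs_integral_shift_sub_le`). -/

/-! ### Densities on finite product spaces -/

theorem lintegral_pi_prod {ι : Type*} [Fintype ι] {E : ι → Type*} [∀ i, MeasurableSpace (E i)]
    (μ : ∀ i, Measure (E i)) [∀ i, IsProbabilityMeasure (μ i)] (f : ∀ i, E i → ℝ≥0∞)
    (hf : ∀ i, Measurable (f i)) :
    ∫⁻ x, ∏ i, f i (x i) ∂(Measure.pi μ) = ∏ i, ∫⁻ x, f i x ∂(μ i) := by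
  have hind : iIndepFun (fun i (x : ∀ i, E i) => f i (x i)) (Measure.pi μ) :=
    iIndepFun_pi fun i => (hf i).aemeasurable
  have h := lintegral_prod_eq_prod_lintegral_of_indepFun Finset.univ _ hind
    (fun i => (hf i).comp (measurable_pi_apply i))
  rw [h]
  refine Finset.prod_congr rfl fun i _ => ?_
  exact (measurePreserving_eval μ i).lintegral_comp (hf i)

theorem pi_withDensity {ι : Type*} [Fintype ι] {E : ι → Type*} [∀ i, MeasurableSpace (E i)]
    (μ : ∀ i, Measure (E i)) [∀ i, IsProbabilityMeasure (μ i)] (f : ∀ i, E i → ℝ≥0∞)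
    (hf : ∀ i, Measurable (f i)) [∀ i, SigmaFinite ((μ i).withDensity (f i))] :
    Measure.pi (fun i => (μ i).withDensity (f i)) =
      (Measure.pi μ).withDensity fun x => ∏ i, f i (x i) := by
  refine Measure.pi_eq fun s hs => ?_
  rw [withDensity_apply _ (MeasurableSet.univ_pi hs),
    ← lintegral_indicator (MeasurableSet.univ_pi hs)]
  have : (Set.univ.pi s).indicator (fun x => ∏ i, f i (x i)) =
      fun x : ∀ i, E i => ∏ i, (s i).indicator (f i) (x i) := by
    ext x
    by_cases hx : x ∈ Set.univ.pi s
    · rw [Set.indicator_of_mem hx]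
      exact Finset.prod_congr rfl fun i _ => (Set.indicator_of_mem (hx i trivial) _).symm
    · rw [Set.indicator_of_notMem hx]
      simp only [Set.mem_pi, Set.mem_univ, true_implies, not_forall] at hx
      obtain ⟨i, hi⟩ := hx
      exact (Finset.prod_eq_zero (Finset.mem_univ i) (Set.indicator_of_notMem hi _)).symm
  rw [this, lintegral_pi_prod μ _ fun i => (hf i).indicator (hs i)]
  refine Finset.prod_congr rfl fun i _ => ?_
  rw [withDensity_apply _ (hs i), lintegral_indicator (hs i)]

/-- Used twice, over the entries of a row and over the rows, to pass from scalar translations to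
matrix translations. -/
theorem pi_map_eq_withDensity {ι : Type*} [Fintype ι] {E : ι → Type*}
    [∀ i, MeasurableSpace (E i)] (μ : ∀ i, Measure (E i)) [∀ i, IsProbabilityMeasure (μ i)]
    (τ : ∀ i, E i → E i) (hτ : ∀ i, Measurable (τ i)) (f : ∀ i, E i → ℝ≥0∞)
    (hf : ∀ i, Measurable (f i)) (h : ∀ i, (μ i).map (τ i) = (μ i).withDensity (f i)) :
    (Measure.pi μ).map (fun x i => τ i (x i)) =
      (Measure.pi μ).withDensity fun x => ∏ i, f i (x i) := by
  have hp (i : ι) : IsProbabilityMeasure ((μ i).map (τ i)) :=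
    Measure.isProbabilityMeasure_map (hτ i).aemeasurable
  have hs (i : ι) : SigmaFinite ((μ i).withDensity (f i)) := by
    rw [← h]; infer_instance
  rw [Measure.pi_map_pi fun i => (hτ i).aemeasurable]
  simp_rw [h]
  exact pi_withDensity μ f hf

/-! ### Translated Gaussian laws -/

instance isProbabilityMeasure_complexGaussian (v : ℝ≥0) :
    IsProbabilityMeasure (complexGaussian v) :=
  Measure.isProbabilityMeasure_map (MeasurableEquiv.measurable _).aemeasurable

instance isProbabilityMeasure_gaussianMatrix (m n : ℕ) (v : ℝ≥0) :
    IsProbabilityMeasure (gaussianMatrix m n v) :=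
  inferInstanceAs (IsProbabilityMeasure
    (Measure.pi fun _ : Fin m => Measure.pi fun _ : Fin n => complexGaussian v))

theorem gaussianReal_map_add_eq_withDensity {w : ℝ≥0} (hw : w ≠ 0) (a : ℝ) :
    (gaussianReal 0 w).map (· + a) = (gaussianReal 0 w).withDensity
      fun x => ENNReal.ofReal (Real.exp (a * x / w - a ^ 2 / (2 * w))) := by
  have hw' : (w : ℝ) ≠ 0 := by exact_mod_cast hw
  rw [gaussianReal_map_add_const, gaussianReal_of_var_ne_zero _ hw,
    gaussianReal_of_var_ne_zero _ hw, ← withDensity_mul _ (measurable_gaussianPDF _ _)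
      (by fun_prop)]
  congr 1
  ext x
  rw [Pi.mul_apply, gaussianPDF, gaussianPDF, ← ENNReal.ofReal_mul (gaussianPDFReal_nonneg _ _ _)]
  congr 1
  rw [gaussianPDFReal, gaussianPDFReal, mul_assoc _ (Real.exp _), ← Real.exp_add]
  congr 2
  field_simp
  ring

/-- Real and imaginary parts are independent with variance `v / 2` each; this is the source of the
factor `2 / v` in the score. -/
theorem complexGaussian_map_add_eq_withDensity {v : ℝ≥0} (hv : v ≠ 0) (a : ℂ) :
    (complexGaussian v).map (· + a) = (complexGaussian v).withDensity
      fun z => ENNReal.ofReal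
        (Real.exp (2 / v * (a.re * z.re + a.im * z.im) - ‖a‖ ^ 2 / v)) := by
  have hw : v / 2 ≠ 0 := by simpa using hv
  have hv' : (v : ℝ) ≠ 0 := by exact_mod_cast hv
  set e := Complex.measurableEquivRealProd.symm
  set γ := gaussianReal 0 (v / 2)
  have h1 : (complexGaussian v).map (· + a) =
      (Measure.prod (γ.map (· + a.re)) (γ.map (· + a.im))).map e := by
    rw [Measure.map_prod_map _ _ (by fun_prop) (by fun_prop), complexGaussian,
      Measure.map_map (by fun_prop) e.measurable,
      Measure.map_map e.measurable (by fun_prop)]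
    congr 1
  rw [h1, gaussianReal_map_add_eq_withDensity hw, gaussianReal_map_add_eq_withDensity hw,
    prod_withDensity (by fun_prop) (by fun_prop), complexGaussian]
  ext s hs
  rw [e.map_apply, withDensity_apply _ (e.measurable hs), withDensity_apply _ hs,
    setLIntegral_map hs (by fun_prop) e.measurable]
  refine lintegral_congr fun x => ?_
  rw [← ENNReal.ofReal_mul (Real.exp_nonneg _), ← Real.exp_add]
  congr 2
  have h2 : (e x).re = x.1 := rfl
  have h3 : (e x).im = x.2 := rfl
  rw [h2, h3, Complex.sq_norm, Complex.normSq_apply]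
  push_cast
  field_simp
  ring

/-! ### Frobenius inner product and matrix likelihood ratio -/

/-- The real inner product of two complex matrices attached to the Frobenius norm. -/
noncomputable def frobInner {m n : ℕ} (X Y : Matrix (Fin m) (Fin n) ℂ) : ℝ :=
  ∑ i, ∑ j, ((X i j).re * (Y i j).re + (X i j).im * (Y i j).im)

theorem frobInner_self {m n : ℕ} (X : Matrix (Fin m) (Fin n) ℂ) : frobInner X X = frobSq X := by
  simp only [frobInner, frobSq, Complex.sq_norm, Complex.normSq_apply]

theorem frobInner_comm {m n : ℕ} (X Y : Matrix (Fin m) (Fin n) ℂ) :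
    frobInner X Y = frobInner Y X := by
  simp only [frobInner, mul_comm]

theorem frobInner_add_left {m n : ℕ} (X Y Z : Matrix (Fin m) (Fin n) ℂ) :
    frobInner (X + Y) Z = frobInner X Z + frobInner Y Z := by
  simp only [frobInner, Matrix.add_apply, Complex.add_re, Complex.add_im,
    ← Finset.sum_add_distrib]
  refine Finset.sum_congr rfl fun i _ => Finset.sum_congr rfl fun j _ => ?_
  ring

theorem frobInner_smul_left {m n : ℕ} (r : ℝ) (X Y : Matrix (Fin m) (Fin n) ℂ) :
    frobInner (r • X) Y = r * frobInner X Y := by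
  simp only [frobInner, Matrix.smul_apply, Complex.smul_re, Complex.smul_im, smul_eq_mul,
    Finset.mul_sum]
  refine Finset.sum_congr rfl fun i _ => Finset.sum_congr rfl fun j _ => ?_
  ring

theorem frobSq_nonneg {m n : ℕ} (X : Matrix (Fin m) (Fin n) ℂ) : 0 ≤ frobSq X :=
  Finset.sum_nonneg fun _ _ => Finset.sum_nonneg fun _ _ => sq_nonneg _

theorem measurable_entry {m n : ℕ} (i : Fin m) (j : Fin n) :
    Measurable fun Z : Matrix (Fin m) (Fin n) ℂ => Z i j :=
  (measurable_pi_apply j).comp (measurable_pi_apply (X := fun _ : Fin m => Fin n → ℂ) i)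

theorem measurable_frobInner {m n : ℕ} (W : Matrix (Fin m) (Fin n) ℂ) :
    Measurable (frobInner W) := by
  unfold frobInner
  refine Finset.measurable_sum _ fun i _ => Finset.measurable_sum _ fun j _ => ?_
  have := measurable_entry (m := m) (n := n) i j
  fun_prop

/-- The likelihood ratio of a Gaussian matrix shifted by `W`. -/
noncomputable def likelihoodRatio {m n : ℕ} (v : ℝ≥0) (W Z : Matrix (Fin m) (Fin n) ℂ) : ℝ :=
  Real.exp (2 / v * frobInner W Z - frobSq W / v)

theorem measurable_likelihoodRatio {m n : ℕ} (v : ℝ≥0) (W : Matrix (Fin m) (Fin n) ℂ) :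
    Measurable (likelihoodRatio v W) := by
  have := measurable_frobInner W
  unfold likelihoodRatio
  fun_prop

theorem gaussianMatrix_map_add_eq_withDensity {m n : ℕ} {v : ℝ≥0} (hv : v ≠ 0)
    (W : Matrix (Fin m) (Fin n) ℂ) :
    (gaussianMatrix m n v).map (W + ·) = (gaussianMatrix m n v).withDensity
      fun Z => ENNReal.ofReal (likelihoodRatio v W Z) := by
  have hm (i : Fin m) : Measurable fun (z : Fin n → ℂ) j => z j + W i j :=
    measurable_pi_lambda _ fun j => (measurable_pi_apply j).add_const _
  have h := pi_map_eq_withDensity (fun _ : Fin m => Measure.pi fun _ : Fin n => complexGaussian v)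
    (fun i z j => z j + W i j) hm _ (fun i => by fun_prop) fun i =>
      pi_map_eq_withDensity (fun _ : Fin n => complexGaussian v) (fun j => (· + W i j))
        (fun j => by fun_prop) _ (fun j => by fun_prop)
        fun j => complexGaussian_map_add_eq_withDensity hv (W i j)
  have h1 : (fun (Z : Fin m → Fin n → ℂ) i j => Z i j + W i j) = (W + ·) := by
    funext Z i j
    exact add_comm _ _
  rw [h1] at h
  refine h.trans ?_
  show Measure.withDensity (Measure.pi _) _ = Measure.withDensity (Measure.pi _) _
  congr 1
  funext Z
  simp_rw [← ENNReal.ofReal_prod_of_nonneg fun _ _ => Real.exp_nonneg _, ← Real.exp_sum]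
  rw [← ENNReal.ofReal_prod_of_nonneg fun _ _ => Real.exp_nonneg _, ← Real.exp_sum]
  congr 2
  simp only [frobInner, frobSq, Finset.mul_sum, Finset.sum_div, Finset.sum_sub_distrib]

/-! ### Exponential moments of a real Gaussian -/

theorem memLp_exp_gaussianReal (w : ℝ≥0) (c d : ℝ) :
    MemLp (fun x => Real.exp (c * x + d)) 2 (gaussianReal 0 w) := by
  rw [memLp_two_iff_integrable_sq (by fun_prop)]
  have : (fun x => Real.exp (c * x + d) ^ 2) =
      fun x => Real.exp (2 * d) * Real.exp ((2 * c) * x) := by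
    ext x
    rw [← Real.exp_add, ← Real.exp_nat_mul]
    congr 1; push_cast; ring
  rw [this]
  exact (integrable_exp_mul_gaussianReal _).const_mul _

theorem integral_exp_mul_gaussianReal (w : ℝ≥0) (t : ℝ) :
    ∫ x, Real.exp (t * x) ∂(gaussianReal 0 w) = Real.exp (w * t ^ 2 / 2) := by
  have := congrFun (mgf_fun_id_gaussianReal (μ := 0) (v := w)) t
  simpa [mgf] using this

/-- The integral is the derivative at `1` of the moment generating function. -/
theorem integral_mul_exp_gaussianReal (w : ℝ≥0) :
    ∫ x, x * Real.exp x ∂(gaussianReal 0 w) = w * Real.exp (w / 2) := by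
  have h := hasDerivAt_mgf (X := fun x : ℝ => x) (μ := gaussianReal 0 w) (t := 1)
    (by rw [integrableExpSet_fun_id_gaussianReal]; simp)
  rw [mgf_fun_id_gaussianReal] at h
  have h2 : HasDerivAt (fun t : ℝ => Real.exp (0 * t + w * t ^ 2 / 2))
      (Real.exp (w / 2) * w) 1 := by
    have : HasDerivAt (fun t : ℝ => 0 * t + w * t ^ 2 / 2) (w : ℝ) 1 := by
      have := ((hasDerivAt_id (1 : ℝ)).const_mul 0).add
        ((((hasDerivAt_id (1 : ℝ)).pow 2).const_mul (w : ℝ)).div_const 2)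
      refine this.congr_deriv ?_
      simp
    convert this.exp using 2
    norm_num
  have := h.unique h2
  simpa [mul_comm] using this

theorem integral_sq_gaussianReal (w : ℝ≥0) : ∫ x, x ^ 2 ∂(gaussianReal 0 w) = w := by
  have h := variance_fun_id_gaussianReal (μ := 0) (v := w)
  rw [variance_eq_integral (by fun_prop)] at h
  simpa using h

/-- With `x` the score and `w` its variance, this is the squared `L²` distance between the
likelihood ratio and its linearization. It is of second order in `w`. -/
theorem integral_sq_exp_sub_gaussianReal (w : ℝ≥0) :
    ∫ x, (Real.exp (x - w / 2) - 1 - x) ^ 2 ∂(gaussianReal 0 w) = Real.exp w - 1 - w := by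
  have hid : MemLp (fun x : ℝ => x) 2 (gaussianReal 0 w) :=
    memLp_id_gaussianReal' 2 (by simp)
  have hexp : MemLp (fun x : ℝ => Real.exp x) 2 (gaussianReal 0 w) := by
    simpa using memLp_exp_gaussianReal w 1 0
  have i1 : Integrable (fun x : ℝ => x) (gaussianReal 0 w) := hid.integrable (by simp)
  have i2 : Integrable (fun x : ℝ => x ^ 2) (gaussianReal 0 w) := hid.integrable_sq
  have i3 : Integrable (fun x : ℝ => Real.exp x) (gaussianReal 0 w) := hexp.integrable (by simp)
  have i4 : Integrable (fun x : ℝ => Real.exp (2 * x)) (gaussianReal 0 w) :=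
    integrable_exp_mul_gaussianReal 2
  have i5 : Integrable (fun x : ℝ => x * Real.exp x) (gaussianReal 0 w) := hid.integrable_mul hexp
  have e : (fun x : ℝ => (Real.exp (x - w / 2) - 1 - x) ^ 2) = fun x =>
      ((Real.exp (-w) * Real.exp (2 * x) + -(2 * Real.exp (-(w / 2))) * Real.exp x) +
        (-(2 * Real.exp (-(w / 2))) * (x * Real.exp x) + 2 * x)) + (x ^ 2 + 1) := by
    ext x
    have h1 : Real.exp (x - w / 2) = Real.exp (-(w / 2)) * Real.exp x := by
      rw [← Real.exp_add]; congr 1; ring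
    have h2 : Real.exp (-w) = Real.exp (-(w / 2)) ^ 2 := by
      rw [← Real.exp_nat_mul]; congr 1; push_cast; ring
    have h3 : Real.exp (2 * x) = Real.exp x ^ 2 := by
      rw [← Real.exp_nat_mul]; norm_num
    rw [h1, h2, h3]
    ring
  have j1 : Integrable (fun x : ℝ => Real.exp (-w) * Real.exp (2 * x) +
      -(2 * Real.exp (-(w / 2))) * Real.exp x) (gaussianReal 0 w) :=
    (i4.const_mul _).add (i3.const_mul _)
  have j2 : Integrable (fun x : ℝ => -(2 * Real.exp (-(w / 2))) * (x * Real.exp x) + 2 * x)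
      (gaussianReal 0 w) := (i5.const_mul _).add (i1.const_mul _)
  have j3 : Integrable (fun x : ℝ => x ^ 2 + 1) (gaussianReal 0 w) := i2.add (integrable_const _)
  have j4 : Integrable (fun x : ℝ => Real.exp (-w) * Real.exp (2 * x) +
      -(2 * Real.exp (-(w / 2))) * Real.exp x +
      (-(2 * Real.exp (-(w / 2))) * (x * Real.exp x) + 2 * x)) (gaussianReal 0 w) := j1.add j2
  rw [e, integral_add j4 j3, integral_add j1 j2,
    integral_add (i4.const_mul _) (i3.const_mul _), integral_add (i5.const_mul _) (i1.const_mul _),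
    integral_add i2 (integrable_const _)]
  simp only [integral_const_mul]
  rw [integral_exp_mul_gaussianReal, integral_mul_exp_gaussianReal, integral_sq_gaussianReal]
  have h0 : ∫ x : ℝ, 2 * x ∂(gaussianReal 0 w) = 0 := by
    rw [integral_const_mul (2 : ℝ) fun x : ℝ => x, integral_id_gaussianReal, mul_zero]
  have h4 : ∫ x, Real.exp x ∂(gaussianReal 0 w) = Real.exp (w / 2) := by
    simpa using integral_exp_mul_gaussianReal w 1
  have h5 : Real.exp (-(w / 2 : ℝ)) * Real.exp (w / 2) = 1 := by
    rw [← Real.exp_add]; simp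
  have h6 : Real.exp (-w) * Real.exp (w * 2 ^ 2 / 2) = Real.exp w := by
    rw [← Real.exp_add]; congr 1; ring
  rw [h0, h4, h6, integral_const]
  simp only [probReal_univ, smul_eq_mul]
  linear_combination (-2 - 2 * (w : ℝ)) * h5

theorem frobSq_smul {m n : ℕ} (r : ℝ) (X : Matrix (Fin m) (Fin n) ℂ) :
    frobSq (r • X) = r ^ 2 * frobSq X := by
  rw [← frobInner_self, frobInner_smul_left, frobInner_comm, frobInner_smul_left, frobInner_self]
  ring

/-! ### Score, Fisher information and linearization of shifts -/

section

variable {m n : ℕ} {v : ℝ≥0}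

theorem likelihoodRatio_nonneg (W Z : Matrix (Fin m) (Fin n) ℂ) : 0 ≤ likelihoodRatio v W Z :=
  Real.exp_nonneg _

theorem lintegral_likelihoodRatio (hv : v ≠ 0) (W : Matrix (Fin m) (Fin n) ℂ) :
    ∫⁻ Z, ENNReal.ofReal (likelihoodRatio v W Z) ∂(gaussianMatrix m n v) = 1 := by
  rw [← setLIntegral_univ, ← withDensity_apply _ MeasurableSet.univ,
    ← gaussianMatrix_map_add_eq_withDensity hv, Measure.map_apply _ MeasurableSet.univ]
  · simp
  · refine measurable_pi_lambda _ fun i => measurable_pi_lambda _ fun j => ?_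
    exact (measurable_entry i j).const_add _

theorem integral_likelihoodRatio (hv : v ≠ 0) (W : Matrix (Fin m) (Fin n) ℂ) :
    ∫ Z, likelihoodRatio v W Z ∂(gaussianMatrix m n v) = 1 := by
  rw [integral_eq_lintegral_of_nonneg_ae
    (Filter.Eventually.of_forall fun Z => likelihoodRatio_nonneg W Z)
    (measurable_likelihoodRatio v W).aestronglyMeasurable, lintegral_likelihoodRatio hv]
  rfl

/-- The score of the Gaussian location family in the direction `W`. -/
noncomputable def score {m n : ℕ} (v : ℝ≥0) (W Z : Matrix (Fin m) (Fin n) ℂ) : ℝ :=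
  2 / v * frobInner W Z

/-- The Fisher information of the Gaussian location family in the direction `W`. -/
noncomputable def fisherInfo {m n : ℕ} (v : ℝ≥0) (W : Matrix (Fin m) (Fin n) ℂ) : ℝ≥0 :=
  (2 / v * frobSq W).toNNReal

theorem coe_fisherInfo (W : Matrix (Fin m) (Fin n) ℂ) :
    (fisherInfo v W : ℝ) = 2 / v * frobSq W :=
  Real.coe_toNNReal _ (mul_nonneg (by positivity) (frobSq_nonneg W))

theorem likelihoodRatio_eq (W Z : Matrix (Fin m) (Fin n) ℂ) :
    likelihoodRatio v W Z = Real.exp (score v W Z - fisherInfo v W / 2) := by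
  rw [likelihoodRatio, score, coe_fisherInfo]
  congr 1
  ring

theorem measurable_score (W : Matrix (Fin m) (Fin n) ℂ) : Measurable (score v W) :=
  (measurable_frobInner W).const_mul _

/-- The likelihood ratio in every direction `t • W` has integral `1`; this computes the moment
generating function of the score for all `t`, which determines its law. -/
theorem map_score (hv : v ≠ 0) (W : Matrix (Fin m) (Fin n) ℂ) :
    (gaussianMatrix m n v).map (score v W) = gaussianReal 0 (fisherInfo v W) := by
  have hmgf : mgf (score v W) (gaussianMatrix m n v) =
      mgf (fun x => x) (gaussianReal 0 (fisherInfo v W)) := by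
    ext t
    rw [mgf_fun_id_gaussianReal, mgf]
    have h := integral_likelihoodRatio hv (t • W)
    have : ∀ Z, likelihoodRatio v (t • W) Z =
        Real.exp (t * score v W Z) * Real.exp (-(fisherInfo v W * t ^ 2 / 2)) := by
      intro Z
      rw [← Real.exp_add, likelihoodRatio, frobInner_smul_left, frobSq_smul, coe_fisherInfo, score]
      congr 1
      ring
    simp_rw [this] at h
    rw [integral_mul_const, Real.exp_neg, mul_inv_eq_one₀ (Real.exp_pos _).ne'] at h
    simpa using h
  have hset := integrableExpSet_eq_of_mgf hmgf
  rw [← Measure.map_id' (μ := gaussianReal 0 (fisherInfo v W))]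
  refine Measure.ext_of_complexMGF_eq (measurable_score W).aemeasurable aemeasurable_id' ?_
  ext z
  refine eqOn_complexMGF_of_mgf hmgf ?_
  rw [hset, integrableExpSet_fun_id_gaussianReal]
  simp

theorem integral_comp_score (hv : v ≠ 0) (W : Matrix (Fin m) (Fin n) ℂ) {f : ℝ → ℝ}
    (hf : Measurable f) :
    ∫ Z, f (score v W Z) ∂(gaussianMatrix m n v) = ∫ x, f x ∂(gaussianReal 0 (fisherInfo v W)) := by
  rw [← map_score hv, integral_map (measurable_score W).aemeasurable hf.aestronglyMeasurable]

theorem memLp_score (hv : v ≠ 0) (W : Matrix (Fin m) (Fin n) ℂ) :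
    MemLp (score v W) 2 (gaussianMatrix m n v) := by
  have h : MemLp (fun x : ℝ => x) 2 ((gaussianMatrix m n v).map (score v W)) := by
    rw [map_score hv]
    exact memLp_id_gaussianReal' 2 (by simp)
  exact h.comp_of_map (measurable_score W).aemeasurable

theorem memLp_likelihoodRatio (hv : v ≠ 0) (W : Matrix (Fin m) (Fin n) ℂ) :
    MemLp (likelihoodRatio v W) 2 (gaussianMatrix m n v) := by
  have h : MemLp (fun x : ℝ => Real.exp (1 * x + -(fisherInfo v W / 2))) 2
      ((gaussianMatrix m n v).map (score v W)) := by
    rw [map_score hv]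
    exact memLp_exp_gaussianReal _ _ _
  have h2 := h.comp_of_map (measurable_score W).aemeasurable
  refine h2.congr_norm ?_ ?_
  · exact (measurable_likelihoodRatio v W).aestronglyMeasurable
  · refine Filter.Eventually.of_forall fun Z => ?_
    simp [likelihoodRatio_eq, sub_eq_add_neg]

theorem integral_score_sq (hv : v ≠ 0) (W : Matrix (Fin m) (Fin n) ℂ) :
    ∫ Z, score v W Z ^ 2 ∂(gaussianMatrix m n v) = fisherInfo v W := by
  rw [integral_comp_score hv W (f := fun x => x ^ 2) (by fun_prop), integral_sq_gaussianReal]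

theorem integral_shift (hv : v ≠ 0) (W : Matrix (Fin m) (Fin n) ℂ)
    (h : Matrix (Fin m) (Fin n) ℂ → ℝ) :
    ∫ Z, h (W + Z) ∂(gaussianMatrix m n v) =
      ∫ Z, likelihoodRatio v W Z * h Z ∂(gaussianMatrix m n v) := by
  have hadd (V : Matrix (Fin m) (Fin n) ℂ) : Measurable (V + ·) :=
    measurable_pi_lambda _ fun i => measurable_pi_lambda _ fun j =>
      (measurable_entry i j).const_add _
  -- Translation is a measurable equivalence, so the change of variables holds for every `h`,
  -- measurable or not.
  let e : Matrix (Fin m) (Fin n) ℂ ≃ᵐ Matrix (Fin m) (Fin n) ℂ :=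
    { toEquiv := Equiv.addLeft W
      measurable_toFun := hadd W
      measurable_invFun := hadd (-W) }
  have h1 := e.measurableEmbedding.integral_map (μ := gaussianMatrix m n v) h
  have h2 : (⇑e) = (W + ·) := rfl
  rw [h2, gaussianMatrix_map_add_eq_withDensity hv,
    integral_withDensity_eq_integral_toReal_smul
      (measurable_likelihoodRatio v W).ennreal_ofReal
      (Filter.Eventually.of_forall fun _ => ENNReal.ofReal_lt_top)] at h1
  rw [← h1]
  refine integral_congr_ae (Filter.Eventually.of_forall fun Z => ?_)
  simp only [smul_eq_mul]
  rw [ENNReal.toReal_ofReal (likelihoodRatio_nonneg W Z)]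

theorem abs_integral_mul_le_sqrt {Ω : Type*} [MeasurableSpace Ω] {μ : Measure Ω} {f g : Ω → ℝ}
    (hf : MemLp f 2 μ) (hg : MemLp g 2 μ) :
    |∫ x, f x * g x ∂μ| ≤ √(∫ x, f x ^ 2 ∂μ) * √(∫ x, g x ^ 2 ∂μ) := by
  have h := integral_mul_norm_le_Lp_mul_Lq (μ := μ) (f := f) (g := g) (p := 2) (q := 2)
    Real.HolderConjugate.two_two (by simpa using hf) (by simpa using hg)
  refine (abs_integral_le_integral_abs).trans ?_
  simp only [abs_mul, Real.sqrt_eq_rpow]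
  simpa using h

/-- The left side pairs `h` with the likelihood ratio minus its linearization, so Cauchy–Schwarz
applies. Only square integrability of `h` at the unshifted law is needed. -/
theorem abs_integral_shift_sub_le (hv : v ≠ 0) (W : Matrix (Fin m) (Fin n) ℂ)
    {h : Matrix (Fin m) (Fin n) ℂ → ℝ} (hh : MemLp h 2 (gaussianMatrix m n v)) :
    |∫ Z, h (W + Z) ∂(gaussianMatrix m n v) - ∫ Z, h Z ∂(gaussianMatrix m n v) -
        ∫ Z, h Z * score v W Z ∂(gaussianMatrix m n v)| ≤
      √(∫ Z, h Z ^ 2 ∂(gaussianMatrix m n v)) *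
        √(Real.exp (fisherInfo v W) - 1 - fisherInfo v W) := by
  have hL := memLp_likelihoodRatio hv W
  have hS := memLp_score hv W
  have hr : MemLp (fun Z => likelihoodRatio v W Z - 1 - score v W Z) 2 (gaussianMatrix m n v) :=
    (hL.sub (memLp_const 1)).sub hS
  have h2 : ∫ Z, (likelihoodRatio v W Z - 1 - score v W Z) ^ 2 ∂(gaussianMatrix m n v) =
      Real.exp (fisherInfo v W) - 1 - fisherInfo v W := by
    rw [← integral_sq_exp_sub_gaussianReal, ← integral_comp_score hv W
      (f := fun x => (Real.exp (x - fisherInfo v W / 2) - 1 - x) ^ 2) (by fun_prop)]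
    simp_rw [likelihoodRatio_eq]
  have h3 : ∫ Z, h (W + Z) ∂(gaussianMatrix m n v) - ∫ Z, h Z ∂(gaussianMatrix m n v) -
        ∫ Z, h Z * score v W Z ∂(gaussianMatrix m n v) =
      ∫ Z, h Z * (likelihoodRatio v W Z - 1 - score v W Z) ∂(gaussianMatrix m n v) := by
    have i1 : Integrable (fun Z => likelihoodRatio v W Z * h Z) (gaussianMatrix m n v) :=
      hL.integrable_mul hh
    have i2 : Integrable (fun Z => h Z * score v W Z) (gaussianMatrix m n v) :=
      hh.integrable_mul hS
    have i3 : Integrable h (gaussianMatrix m n v) := hh.integrable (by simp)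
    have i4 : Integrable (fun Z => likelihoodRatio v W Z * h Z - h Z) (gaussianMatrix m n v) :=
      i1.sub i3
    rw [integral_shift hv, ← integral_sub i1 i3, ← integral_sub i4 i2]
    refine integral_congr_ae (Filter.Eventually.of_forall fun Z => ?_)
    ring
  rw [h3, ← h2]
  exact abs_integral_mul_le_sqrt hh hr

end

/-! ### Differentiation along curves of matrices -/

theorem frobSq_eq_zero {m n : ℕ} {X : Matrix (Fin m) (Fin n) ℂ} (h : frobSq X = 0) : X = 0 := by
  ext i j
  rw [frobSq, Finset.sum_eq_zero_iff_of_nonneg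
    fun _ _ => Finset.sum_nonneg fun _ _ => sq_nonneg _] at h
  have h1 := h i (Finset.mem_univ i)
  rw [Finset.sum_eq_zero_iff_of_nonneg fun _ _ => sq_nonneg _] at h1
  simpa using h1 j (Finset.mem_univ j)

/-- Entrywise differentiability at the origin of a curve of matrices. -/
def HasEntryDerivAt {m n : ℕ} (γ : ℝ → Matrix (Fin m) (Fin n) ℂ) (D : Matrix (Fin m) (Fin n) ℂ) :
    Prop :=
  ∀ i j, HasDerivAt (fun t => γ t i j) (D i j) 0

theorem HasEntryDerivAt.hasDerivAt_apply {m n : ℕ} {E : Type*} [NormedAddCommGroup E]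
    [NormedSpace ℝ E] {γ : ℝ → Matrix (Fin m) (Fin n) ℂ} {D : Matrix (Fin m) (Fin n) ℂ}
    (h : HasEntryDerivAt γ D) (ℓ : Matrix (Fin m) (Fin n) ℂ →ₗ[ℝ] E) :
    HasDerivAt (fun t => ℓ (γ t)) (ℓ D) 0 := by
  let ℓ' : (Fin m → Fin n → ℂ) →L[ℝ] E := LinearMap.toContinuousLinearMap
    (ℓ : (Fin m → Fin n → ℂ) →ₗ[ℝ] E)
  have h1 : HasDerivAt (fun t => (γ t : Fin m → Fin n → ℂ)) (D : Fin m → Fin n → ℂ) 0 :=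
    hasDerivAt_pi.2 fun i => hasDerivAt_pi.2 fun j => h i j
  exact ℓ'.hasFDerivAt.comp_hasDerivAt 0 h1

theorem HasEntryDerivAt.map {m n p q : ℕ} {γ : ℝ → Matrix (Fin m) (Fin n) ℂ}
    {D : Matrix (Fin m) (Fin n) ℂ} (h : HasEntryDerivAt γ D)
    (R : Matrix (Fin m) (Fin n) ℂ →ₗ[ℝ] Matrix (Fin p) (Fin q) ℂ) :
    HasEntryDerivAt (fun t => R (γ t)) (R D) := fun i j =>
  h.hasDerivAt_apply ((Matrix.entryLinearMap ℝ ℂ i j).comp R)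

theorem HasEntryDerivAt.sub_const {m n : ℕ} {γ : ℝ → Matrix (Fin m) (Fin n) ℂ}
    {D : Matrix (Fin m) (Fin n) ℂ} (h : HasEntryDerivAt γ D) (X : Matrix (Fin m) (Fin n) ℂ) :
    HasEntryDerivAt (fun t => γ t - X) D := fun i j => (h i j).sub_const (X i j)

theorem HasEntryDerivAt.frobSq {m n : ℕ} {γ : ℝ → Matrix (Fin m) (Fin n) ℂ}
    {D : Matrix (Fin m) (Fin n) ℂ} (h : HasEntryDerivAt γ D) (h0 : γ 0 = 0) :
    HasDerivAt (fun t => frobSq (γ t)) 0 0 := by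
  have h1 (i : Fin m) (j : Fin n) : HasDerivAt (fun t => ‖γ t i j‖ ^ 2) 0 0 := by
    refine ((h i j).norm_sq).congr_deriv ?_
    simp [h0]
  have := HasDerivAt.fun_sum fun i (_ : i ∈ Finset.univ) =>
    HasDerivAt.fun_sum fun j (_ : j ∈ Finset.univ) => h1 i j
  simpa [_root_.frobSq] using this

section

variable {m n : ℕ} {v : ℝ≥0}

/-- Pairing of a square integrable function with the score, as a function of the direction. -/
noncomputable def scorePairing (hv : v ≠ 0) {h : Matrix (Fin m) (Fin n) ℂ → ℝ}
    (hh : MemLp h 2 (gaussianMatrix m n v)) : Matrix (Fin m) (Fin n) ℂ →ₗ[ℝ] ℝ where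
  toFun W := ∫ Z, h Z * score v W Z ∂(gaussianMatrix m n v)
  map_add' W V := by
    have i1 : Integrable (fun Z => h Z * score v W Z) (gaussianMatrix m n v) :=
      hh.integrable_mul (memLp_score hv W)
    have i2 : Integrable (fun Z => h Z * score v V Z) (gaussianMatrix m n v) :=
      hh.integrable_mul (memLp_score hv V)
    rw [← integral_add i1 i2]
    simp only [score, frobInner_add_left, mul_add]
  map_smul' r W := by
    rw [RingHom.id_apply, smul_eq_mul, ← integral_const_mul]
    simp only [score, frobInner_smul_left]
    refine integral_congr_ae (Filter.Eventually.of_forall fun Z => ?_)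
    ring

/-- The linear term is the score pairing. The remainder is bounded by a multiple of the Fisher
information of `W t`, which is quadratic in `W t` and so has zero derivative at `0`. -/
theorem hasDerivAt_integral_shift (hv : v ≠ 0) {h : Matrix (Fin m) (Fin n) ℂ → ℝ}
    (hh : MemLp h 2 (gaussianMatrix m n v)) {W : ℝ → Matrix (Fin m) (Fin n) ℂ}
    {D : Matrix (Fin m) (Fin n) ℂ} (hW : HasEntryDerivAt W D) (hW0 : W 0 = 0) :
    HasDerivAt (fun t => ∫ Z, h (W t + Z) ∂(gaussianMatrix m n v)) (scorePairing hv hh D) 0 := by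
  set C := √(∫ Z, h Z ^ 2 ∂(gaussianMatrix m n v))
  have hC : 0 ≤ C := Real.sqrt_nonneg _
  have hq : HasDerivAt (fun t => (fisherInfo v (W t) : ℝ)) 0 0 := by
    simp only [coe_fisherInfo]
    simpa using (hW.frobSq hW0).const_mul (2 / (v : ℝ))
  have hq0 : (fisherInfo v (W 0) : ℝ) = 0 := by simp [coe_fisherInfo, hW0, frobSq]
  set r : ℝ → ℝ := fun t => ∫ Z, h (W t + Z) ∂(gaussianMatrix m n v) -
    ∫ Z, h Z ∂(gaussianMatrix m n v) - scorePairing hv hh (W t) with hr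
  have hr0 : r 0 = 0 := by simp [hr, hW0]
  have hsmall : ∀ᶠ t in nhds (0 : ℝ), (fisherInfo v (W t) : ℝ) ≤ 1 := by
    have := hq.continuousAt.tendsto
    rw [hq0] at this
    exact this.eventually_le_const one_pos
  have hbound : ∀ᶠ t in nhds (0 : ℝ), ‖r t‖ ≤ C * ‖(fisherInfo v (W t) : ℝ)‖ := by
    filter_upwards [hsmall] with t ht
    have h1 := abs_integral_shift_sub_le hv (W t) hh
    refine h1.trans (mul_le_mul_of_nonneg_left ?_ hC)
    have hn : (0 : ℝ) ≤ fisherInfo v (W t) := NNReal.coe_nonneg _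
    rw [Real.norm_of_nonneg hn]
    refine Real.sqrt_le_iff.2 ⟨hn, ?_⟩
    -- For `0 ≤ q ≤ 1`, `exp q - 1 - q ≤ q ^ 2`, so the square root is at most `q`.
    exact (le_abs_self _).trans (Real.abs_exp_sub_one_sub_id_le (by rwa [abs_of_nonneg hn]))
  have hrd : HasDerivAt r 0 0 := by
    rw [hasDerivAt_iff_isLittleO_nhds_zero] at hq ⊢
    simp only [zero_add, hq0, hr0, sub_zero, smul_zero] at hq ⊢
    exact (Asymptotics.IsBigO.of_bound C hbound).trans_isLittleO hq
  have := (hrd.add (hW.hasDerivAt_apply (scorePairing hv hh))).add_const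
    (∫ Z, h Z ∂(gaussianMatrix m n v))
  rw [zero_add] at this
  refine this.congr_of_eventuallyEq (Filter.Eventually.of_forall fun t => ?_)
  simp [hr]

/-! ### Tangent vectors and the Cramér–Rao bound -/

/-- The velocities at `X` of curves in a set of matrices. -/
def tangentVectors (S : Set (Matrix (Fin m) (Fin n) ℂ)) (X : Matrix (Fin m) (Fin n) ℂ) :
    Set (Matrix (Fin m) (Fin n) ℂ) :=
  {D | ∃ γ : ℝ → Matrix (Fin m) (Fin n) ℂ, γ 0 = X ∧ (∀ t, γ t ∈ S) ∧ HasEntryDerivAt γ D}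

/-- An orthonormal basis of `T`; of orthonormality only unit length and Bessel's inequality are
kept. -/
theorem exists_frobInner_orthonormal (T : Submodule ℝ (Matrix (Fin m) (Fin n) ℂ)) :
    ∃ D : Fin (Module.finrank ℝ T) → Matrix (Fin m) (Fin n) ℂ, (∀ k, D k ∈ T) ∧
      (∀ k, frobSq (D k) = 1) ∧ ∀ X, ∑ k, frobInner X (D k) ^ 2 ≤ frobSq X := by
  let core : InnerProductSpace.Core ℝ (Matrix (Fin m) (Fin n) ℂ) :=
    { inner := frobInner
      conj_inner_symm := fun X Y => frobInner_comm Y X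
      re_inner_nonneg := fun X => (frobInner_self X).symm ▸ frobSq_nonneg X
      add_left := frobInner_add_left
      smul_left := fun X Y r => frobInner_smul_left r X Y
      definite := fun X h => frobSq_eq_zero (by rw [← frobInner_self]; exact h) }
  let _ : NormedAddCommGroup (Matrix (Fin m) (Fin n) ℂ) := core.toNormedAddCommGroup
  let _ : InnerProductSpace ℝ (Matrix (Fin m) (Fin n) ℂ) := InnerProductSpace.ofCore core.toCore
  have hinner (X Y : Matrix (Fin m) (Fin n) ℂ) : inner ℝ X Y = frobInner X Y := rfl
  have hnorm (X : Matrix (Fin m) (Fin n) ℂ) : ‖X‖ ^ 2 = frobSq X := by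
    rw [← real_inner_self_eq_norm_sq, hinner, frobInner_self]
  let b := stdOrthonormalBasis ℝ T
  have hb : Orthonormal ℝ fun k => (b k : Matrix (Fin m) (Fin n) ℂ) :=
    b.orthonormal.comp_linearIsometry T.subtypeₗᵢ
  refine ⟨fun k => b k, fun k => (b k).2, fun k => ?_, fun X => ?_⟩
  · rw [← hnorm, hb.norm_eq_one, one_pow]
  · have h := hb.sum_inner_products_le X (s := Finset.univ)
    rw [hnorm] at h
    refine le_trans (Finset.sum_le_sum fun k _ => ?_) h
    rw [Real.norm_eq_abs, sq_abs, hinner, frobInner_comm]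

/-- The real inner product with a fixed matrix as a linear map. -/
noncomputable def frobInnerLin (D : Matrix (Fin m) (Fin n) ℂ) : Matrix (Fin m) (Fin n) ℂ →ₗ[ℝ] ℝ where
  toFun X := frobInner X D
  map_add' X Y := frobInner_add_left X Y D
  map_smul' r X := frobInner_smul_left r X D

theorem integral_frobInner {Ω : Type*} [MeasurableSpace Ω] {μ : Measure Ω}
    {F : Ω → Matrix (Fin m) (Fin n) ℂ} (hF : ∀ i j, Integrable (fun x => F x i j) μ)
    (D : Matrix (Fin m) (Fin n) ℂ) :
    ∫ x, frobInner (F x) D ∂μ = frobInner (Matrix.of fun i j => ∫ x, F x i j ∂μ) D := by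
  have hre (i : Fin m) (j : Fin n) :
      Integrable (fun x => (F x i j).re * (D i j).re) μ := (hF i j).re.mul_const _
  have him (i : Fin m) (j : Fin n) :
      Integrable (fun x => (F x i j).im * (D i j).im) μ := (hF i j).im.mul_const _
  have hs (i : Fin m) (j : Fin n) : Integrable (fun x => (F x i j).re * (D i j).re +
      (F x i j).im * (D i j).im) μ := (hre i j).add (him i j)
  simp only [frobInner, Matrix.of_apply]
  rw [integral_finsetSum _ fun i _ => integrable_finsetSum _ fun j _ => hs i j]
  refine Finset.sum_congr rfl fun i _ => ?_
  rw [integral_finsetSum _ fun j _ => hs i j]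
  refine Finset.sum_congr rfl fun j _ => ?_
  rw [integral_add (hre i j) (him i j), integral_mul_const, integral_mul_const]
  have h1 : ∫ x, (F x i j).re ∂μ = (∫ x, F x i j ∂μ).re := integral_re (hF i j)
  have h2 : ∫ x, (F x i j).im ∂μ = (∫ x, F x i j ∂μ).im := integral_im (hF i j)
  rw [h1, h2]

theorem memLp_frobInner {Ω : Type*} [MeasurableSpace Ω] {μ : Measure Ω}
    {F : Ω → Matrix (Fin m) (Fin n) ℂ} (hF : ∀ i j, MemLp (fun x => F x i j) 2 μ)
    (D : Matrix (Fin m) (Fin n) ℂ) : MemLp (fun x => frobInner (F x) D) 2 μ := by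
  refine memLp_finsetSum _ fun i _ => memLp_finsetSum _ fun j _ => ?_
  exact ((hF i j).re.mul_const (D i j).re).add ((hF i j).im.mul_const (D i j).im)

theorem integrable_frobSq {Ω : Type*} [MeasurableSpace Ω] {μ : Measure Ω}
    {F : Ω → Matrix (Fin m) (Fin n) ℂ} (hF : ∀ i j, MemLp (fun x => F x i j) 2 μ) :
    Integrable (fun x => frobSq (F x)) μ :=
  integrable_finsetSum _ fun i _ => integrable_finsetSum _ fun j _ =>
    (memLp_two_iff_integrable_sq_norm (hF i j).1).1 (hF i j)

theorem memLp_entry_of_lintegral_frobSq_ne_top {Ω : Type*} [MeasurableSpace Ω] {μ : Measure Ω}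
    {F : Ω → Matrix (Fin m) (Fin n) ℂ} (hF : ∀ i j, AEStronglyMeasurable (fun x => F x i j) μ)
    (h : ∫⁻ x, ENNReal.ofReal (frobSq (F x)) ∂μ ≠ ⊤) (i : Fin m) (j : Fin n) :
    MemLp (fun x => F x i j) 2 μ := by
  rw [memLp_two_iff_integrable_sq_norm (hF i j)]
  refine ⟨(hF i j).norm.pow 2, lt_of_le_of_lt (lintegral_mono fun x => ?_) h.lt_top⟩
  rw [Real.enorm_of_nonneg (sq_nonneg _)]
  refine ENNReal.ofReal_le_ofReal ?_
  refine le_trans ?_ (Finset.single_le_sum (fun i _ => Finset.sum_nonneg fun _ _ => sq_nonneg _)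
    (Finset.mem_univ i))
  exact Finset.single_le_sum (f := fun j => ‖F x i j‖ ^ 2) (fun _ _ => sq_nonneg _)
    (Finset.mem_univ j)

/-- The Cramér–Rao bound for estimation of a matrix in a model set from Gaussian observations of
randomly chosen linear images that preserve the squared Frobenius norm up to a factor `ρ` on
average. -/
theorem cramerRao_random_sampling {p q : ℕ} {α : Type*} [Fintype α] [Nonempty α] (hv : v ≠ 0)
    (R : α → Matrix (Fin m) (Fin n) ℂ →ₗ[ℝ] Matrix (Fin p) (Fin q) ℂ) {ρ : ℝ} (hρ : 0 < ρ)
    (hR : ∀ D, (Fintype.card α : ℝ)⁻¹ * ∑ a, frobSq (R a D) = ρ * frobSq D)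
    (est : α → Matrix (Fin p) (Fin q) ℂ → Matrix (Fin m) (Fin n) ℂ)
    (S : Set (Matrix (Fin m) (Fin n) ℂ))
    (hest : ∀ X ∈ S, ∀ i j,
      (∀ a, Integrable (fun Z => est a (R a X + Z) i j) (gaussianMatrix p q v)) ∧
      (Fintype.card α : ℂ)⁻¹ * ∑ a, ∫ Z, est a (R a X + Z) i j ∂(gaussianMatrix p q v) = X i j)
    {X : Matrix (Fin m) (Fin n) ℂ} (hX : X ∈ S) :
    ENNReal.ofReal (Module.finrank ℝ (Submodule.span ℝ (tangentVectors S X)) * (v / (2 * ρ))) ≤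
      (Fintype.card α : ℝ≥0∞)⁻¹ * ∑ a, ∫⁻ Z, ENNReal.ofReal (frobSq (est a (R a X + Z) - X))
        ∂(gaussianMatrix p q v) := by
  set μ := gaussianMatrix p q v with hμ
  set c : ℝ := (Fintype.card α : ℝ) with hc
  have hcpos : 0 < c := Nat.cast_pos.2 Fintype.card_pos
  have hvpos : (0 : ℝ) < v := by exact_mod_cast pos_iff_ne_zero.2 hv
  -- An infinite error for one sample makes the bound trivial. Otherwise all error entries are
  -- square integrable at `X`.
  by_cases htop : ∃ a, ∫⁻ Z, ENNReal.ofReal (frobSq (est a (R a X + Z) - X)) ∂μ = ⊤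
  · obtain ⟨a, ha⟩ := htop
    have : ∑ a, ∫⁻ Z, ENNReal.ofReal (frobSq (est a (R a X + Z) - X)) ∂μ = ⊤ :=
      ENNReal.sum_eq_top.2 ⟨a, Finset.mem_univ a, ha⟩
    rw [this, ENNReal.mul_top (by simp)]
    exact le_top
  push Not at htop
  have hint (Y) (hY : Y ∈ S) (a) (i) (j) :
      Integrable (fun Z => (est a (R a Y + Z) - X) i j) μ :=
    ((hest Y hY i j).1 a).sub (integrable_const (X i j))
  have hmem (a) (i) (j) : MemLp (fun Z => (est a (R a X + Z) - X) i j) 2 μ :=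
    memLp_entry_of_lintegral_frobSq_ne_top (fun i j => (hint X hX a i j).1) (htop a) i j
  have hmemD (a) (D) : MemLp (fun Z => frobInner (est a (R a X + Z) - X) D) 2 μ :=
    memLp_frobInner (hmem a) D
  -- Unbiasedness at `Y` with the error still centred at the fixed point `X`, so that `Y` can vary
  -- along curves.
  have hmean (Y) (hY : Y ∈ S) (D) :
      c⁻¹ * ∑ a, ∫ Z, frobInner (est a (R a Y + Z) - X) D ∂μ = frobInner (Y - X) D := by
    have h1 (a) : ∫ Z, frobInner (est a (R a Y + Z) - X) D ∂μ = frobInnerLin D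
        (Matrix.of fun i j => ∫ Z, (est a (R a Y + Z) - X) i j ∂μ) :=
      integral_frobInner (hint Y hY a) D
    simp_rw [h1]
    rw [← map_sum, ← smul_eq_mul, ← map_smul]
    change frobInner _ D = _
    congr 1
    ext i j
    have h2 (a) : ∫ Z, est a (R a Y + Z) i j - X i j ∂μ =
        ∫ Z, est a (R a Y + Z) i j ∂μ - X i j := by
      simpa using integral_sub ((hest Y hY i j).1 a) (integrable_const (X i j))
    simp only [Matrix.smul_apply, Matrix.sum_apply, Matrix.of_apply, Matrix.sub_apply]
    simp_rw [h2]
    rw [Finset.sum_sub_distrib, Finset.sum_const, Finset.card_univ, ← (hest Y hY i j).2,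
      Complex.real_smul]
    have hc0 : (Fintype.card α : ℂ) ≠ 0 := Nat.cast_ne_zero.2 Fintype.card_ne_zero
    rw [nsmul_eq_mul, hc]
    push_cast
    field_simp
  -- The derivative of `hmean` along a curve. Both sides are linear in the velocity, so the identity
  -- extends to the span.
  have hscore (D') : Set.EqOn (c⁻¹ • ∑ a, (scorePairing hv (hmemD a D')).comp (R a))
      (frobInnerLin D') (tangentVectors S X) := by
    rintro D ⟨γ, h0, hγ, hD⟩
    have h1 (a) : HasDerivAt (fun t => ∫ Z, frobInner (est a (R a (γ t) + Z) - X) D' ∂μ)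
        (scorePairing hv (hmemD a D') (R a D)) 0 := by
      have h2 := hasDerivAt_integral_shift hv (hmemD a D') ((hD.sub_const X).map (R a))
        (by simp [h0])
      refine h2.congr_of_eventuallyEq (Filter.Eventually.of_forall fun t => ?_)
      refine integral_congr_ae (Filter.Eventually.of_forall fun Z => ?_)
      simp only [← add_assoc, map_sub, add_sub_cancel]
    have h2 := (HasDerivAt.fun_sum fun a (_ : a ∈ Finset.univ) => h1 a).const_mul c⁻¹
    have h3 := (hD.sub_const X).hasDerivAt_apply (frobInnerLin D')
    have h4 := h2.congr_of_eventuallyEq (Filter.Eventually.of_forall fun t =>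
      (hmean (γ t) (hγ t) D').symm)
    have h5 := h4.unique h3
    simpa using h5
  obtain ⟨D, hDT, hDn, hDle⟩ :=
    exists_frobInner_orthonormal (Submodule.span ℝ (tangentVectors S X))
  have hvar (k) : v / (2 * ρ) ≤
      c⁻¹ * ∑ a, ∫ Z, frobInner (est a (R a X + Z) - X) (D k) ^ 2 ∂μ := by
    -- `κ` is the average Fisher information of a unit direction. With this weight, `x * y ≤ (κ * x
    -- ^ 2 + κ⁻¹ * y ^ 2) / 2` does the work of Cauchy–Schwarz over noise and sample jointly,
    -- without loss.
    set κ : ℝ := 2 * ρ / v with hκ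
    have hκpos : 0 < κ := by positivity
    have h1 := LinearMap.eqOn_span (hscore (D k)) (hDT k)
    have h2 : frobInnerLin (D k) (D k) = 1 := by
      rw [← hDn k, ← frobInner_self]; rfl
    rw [h2] at h1
    have h3 (a) : scorePairing hv (hmemD a (D k)) (R a (D k)) ≤
        (κ * ∫ Z, frobInner (est a (R a X + Z) - X) (D k) ^ 2 ∂μ +
          κ⁻¹ * (2 / v * frobSq (R a (D k)))) / 2 := by
      rw [← coe_fisherInfo, ← integral_score_sq hv, ← integral_const_mul, ← integral_const_mul,
        ← integral_add ((hmemD a (D k)).integrable_sq.const_mul κ)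
          ((memLp_score hv _).integrable_sq.const_mul κ⁻¹), ← integral_div]
      refine integral_mono ((hmemD a (D k)).integrable_mul (memLp_score hv _))
        ((((hmemD a (D k)).integrable_sq.const_mul κ).add
          ((memLp_score hv _).integrable_sq.const_mul κ⁻¹)).div_const 2) fun Z => ?_
      beta_reduce
      generalize frobInner (est a (R a X + Z) - X) (D k) = x
      generalize score v (R a (D k)) Z = y
      have : 0 ≤ κ⁻¹ * (κ * x - y) ^ 2 := by positivity
      have h4 : κ⁻¹ * (κ * x - y) ^ 2 = κ * x ^ 2 + κ⁻¹ * y ^ 2 - 2 * (x * y) := by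
        field_simp
        ring
      linarith
    have h4 : c⁻¹ * ∑ a, scorePairing hv (hmemD a (D k)) (R a (D k)) = 1 := by simpa using h1
    have h5 := mul_le_mul_of_nonneg_left
      (Finset.sum_le_sum fun a (_ : a ∈ Finset.univ) => h3 a) (inv_nonneg.2 hcpos.le)
    rw [h4, ← Finset.sum_div, Finset.sum_add_distrib, ← Finset.mul_sum, ← Finset.mul_sum,
      ← Finset.mul_sum] at h5
    have h6 := hR (D k)
    rw [hDn, mul_one] at h6
    set A := ∑ a, ∫ Z, frobInner (est a (R a X + Z) - X) (D k) ^ 2 ∂μ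
    set B := ∑ a, frobSq (R a (D k))
    have h7 : c⁻¹ * ((κ * A + κ⁻¹ * (2 / v * B)) / 2) =
        (κ * (c⁻¹ * A) + κ⁻¹ * (2 / v) * (c⁻¹ * B)) / 2 := by ring
    have h8 : κ⁻¹ * (2 / v) * ρ = 1 := by rw [hκ]; field_simp
    rw [h7, h6, h8] at h5
    have h9 : (v : ℝ) / (2 * ρ) = κ⁻¹ := by rw [hκ, inv_div]
    rw [h9, inv_le_iff_one_le_mul₀' hκpos]
    linarith
  have hsum : Module.finrank ℝ (Submodule.span ℝ (tangentVectors S X)) * (v / (2 * ρ)) ≤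
      c⁻¹ * ∑ a, ∫ Z, frobSq (est a (R a X + Z) - X) ∂μ := by
    have h1 := Finset.sum_le_sum fun k (_ : k ∈ Finset.univ) => hvar k
    rw [Finset.sum_const, Finset.card_univ, Fintype.card_fin, nsmul_eq_mul, ← Finset.mul_sum,
      Finset.sum_comm] at h1
    refine h1.trans (mul_le_mul_of_nonneg_left (Finset.sum_le_sum fun a _ => ?_)
      (inv_nonneg.2 hcpos.le))
    rw [← integral_finsetSum _ fun k _ => (hmemD a (D k)).integrable_sq]
    exact integral_mono (integrable_finsetSum _ fun k _ => (hmemD a (D k)).integrable_sq)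
      (integrable_frobSq (hmem a)) fun Z => hDle _
  refine (ENNReal.ofReal_le_ofReal hsum).trans (le_of_eq ?_)
  rw [ENNReal.ofReal_mul (inv_nonneg.2 hcpos.le), ENNReal.ofReal_inv_of_pos hcpos,
    ENNReal.ofReal_sum_of_nonneg fun a _ => integral_nonneg fun Z => frobSq_nonneg _, hc,
    ENNReal.ofReal_natCast]
  congr 1
  refine Finset.sum_congr rfl fun a _ => ?_
  rw [ofReal_integral_eq_lintegral_ofReal (integrable_frobSq (hmem a))
    (Filter.Eventually.of_forall fun Z => frobSq_nonneg _)]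

end

/-! ### Complex exponential sequences -/

/-- The point of the unit circle whose powers form the complex exponential sequence. -/
noncomputable def expNode (φ : ℝ) : ℂ := Complex.exp (-(Complex.I * 2 * Real.pi * φ))

theorem expNode_ne_zero (φ : ℝ) : expNode φ ≠ 0 := Complex.exp_ne_zero _

theorem expSeq_eq_pow (K : ℕ) (φ : ℝ) (k : Fin K) : expSeq K φ k = expNode φ ^ (k : ℕ) := by
  rw [expNode, ← Complex.exp_nat_mul, expSeq]
  congr 1
  ring

theorem expNode_fract (φ : ℝ) : expNode (Int.fract φ) = expNode φ := by
  rw [expNode, expNode, Complex.exp_eq_exp_iff_exists_int]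
  refine ⟨⌊φ⌋, ?_⟩
  rw [Int.fract]
  push_cast
  ring

theorem expSeq_fract (K : ℕ) (φ : ℝ) : expSeq K (Int.fract φ) = expSeq K φ := by
  ext k
  simp only [expSeq_eq_pow, expNode_fract]

theorem expSeq_congr {K : ℕ} {φ ψ : ℝ} (h : expNode φ = expNode ψ) : expSeq K φ = expSeq K ψ := by
  ext k
  simp only [expSeq_eq_pow, h]

/-- These nodes are the `M`-th roots of unity; they give `M` independent exponentials in the
degenerate case. -/
theorem expNode_div_injective {M : ℕ} (hM : M ≠ 0) :
    Function.Injective fun k : Fin M => expNode ((k : ℕ) / M) := by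
  have h := (Complex.isPrimitiveRoot_exp M hM).inv
  intro k l hkl
  have e (k : Fin M) : expNode ((k : ℕ) / M) =
      (Complex.exp (2 * Real.pi * Complex.I / M))⁻¹ ^ (k : ℕ) := by
    rw [← Complex.exp_neg, ← Complex.exp_nat_mul, expNode]
    congr 1
    push_cast
    ring
  simp only [e] at hkl
  exact Fin.ext (h.pow_inj k.2 l.2 hkl)

/-- Frequencies count only modulo `1`, so the interval constraint creates no boundary and curves may
move them freely. -/
theorem sum_vecMulVec_expSeq_mem_columnMMV (M K : ℕ) {L : ℕ} (θ : Fin L → ℝ)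
    (b : Fin L → Fin K → ℂ) :
    ∑ l, Matrix.vecMulVec (expSeq M (θ l)) (star (b l)) ∈ columnMMV M K L := by
  refine ⟨fun l => Int.fract (θ l), b,
    fun l => ⟨Int.fract_nonneg _, (Int.fract_lt_one _).le⟩, ?_⟩
  simp only [expSeq_fract]

/-- The derivative of the complex exponential sequence with respect to the frequency. -/
noncomputable def expSeqDeriv (K : ℕ) (φ : ℝ) : Fin K → ℂ :=
  fun k => -(Complex.I * 2 * Real.pi * (k : ℕ)) * expSeq K φ k

theorem hasDerivAt_expSeq (K : ℕ) (φ r : ℝ) (k : Fin K) :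
    HasDerivAt (fun t : ℝ => expSeq K (φ + t * r) k) (r * expSeqDeriv K φ k) 0 := by
  have h1 : HasDerivAt (fun t : ℝ => φ + t * r) r 0 := by
    simpa using ((hasDerivAt_id (0 : ℝ)).mul_const r).const_add φ
  have h2 := h1.ofReal_comp
  have h3 : HasDerivAt (fun t : ℝ => -(Complex.I * 2 * Real.pi * ((φ + t * r : ℝ) : ℂ) * (k : ℕ)))
      (-(Complex.I * 2 * Real.pi * r * (k : ℕ))) 0 :=
    ((h2.const_mul (Complex.I * 2 * Real.pi)).mul_const ((k : ℕ) : ℂ)).neg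
  refine h3.cexp.congr_deriv ?_
  simp only [expSeqDeriv, expSeq, zero_mul, add_zero]
  ring

/-! ### Dimension of the tangent span -/

/-- The differential of `(θ, b) ↦ ∑ l, f(θ l) (b l)ᴴ`. -/
noncomputable def columnDifferential (M : ℕ) {K L : ℕ} (θ : Fin L → ℝ) (b : Fin L → Fin K → ℂ) :
    (Fin L → Fin K → ℂ) × (Fin L → ℝ) →ₗ[ℝ] Matrix (Fin M) (Fin K) ℂ where
  toFun p := Matrix.of fun i j => ∑ l, (expSeq M (θ l) i * star (p.1 l j) +
    p.2 l * expSeqDeriv M (θ l) i * star (b l j))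
  map_add' p q := by
    ext i j
    simp only [Matrix.of_apply, Matrix.add_apply, ← Finset.sum_add_distrib, Prod.fst_add,
      Prod.snd_add, Pi.add_apply, star_add, Complex.ofReal_add]
    refine Finset.sum_congr rfl fun l _ => ?_
    ring
  map_smul' r p := by
    ext i j
    simp only [Matrix.of_apply, Matrix.smul_apply, Finset.smul_sum, Prod.smul_fst, Prod.smul_snd,
      Pi.smul_apply, smul_eq_mul, Complex.ofReal_mul, RingHom.id_apply,
      Complex.real_smul, star_mul', Complex.star_def, Complex.conj_ofReal]
    refine Finset.sum_congr rfl fun l _ => ?_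
    ring

theorem columnDifferential_mem_tangentVectors (M : ℕ) {K L : ℕ} (θ : Fin L → ℝ)
    (b : Fin L → Fin K → ℂ) (p : (Fin L → Fin K → ℂ) × (Fin L → ℝ)) :
    columnDifferential M θ b p ∈ tangentVectors (columnMMV M K L)
      (∑ l, Matrix.vecMulVec (expSeq M (θ l)) (star (b l))) := by
  refine ⟨fun t => ∑ l, Matrix.vecMulVec (expSeq M (θ l + t * p.2 l)) (star (b l + t • p.1 l)),
    by simp, fun t => sum_vecMulVec_expSeq_mem_columnMMV M K _ _, fun i j => ?_⟩
  simp only [Matrix.sum_apply, Matrix.vecMulVec_apply]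
  refine HasDerivAt.fun_sum fun l _ => ?_
  have h1 : HasDerivAt (fun t : ℝ => star (b l + t • p.1 l) j) (star (p.1 l j)) 0 := by
    have : HasDerivAt (fun t : ℝ => b l j + t • p.1 l j) (p.1 l j) 0 := by
      simpa using ((hasDerivAt_id (0 : ℝ)).smul_const (p.1 l j)).const_add (b l j)
    exact this.star
  refine ((hasDerivAt_expSeq M (θ l) (p.2 l) i).mul h1).congr_deriv ?_
  simp
  ring

/-- Hermite interpolation: the relations say that a functional in the values and derivatives at the
nodes kills all polynomials of degree below `M`, and suitable test polynomials isolate each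
coefficient. -/
theorem eq_zero_of_sum_confluent_pow_eq_zero {M L : ℕ} (hLM : 2 * L ≤ M) {z : Fin L → ℂ}
    (hz : Function.Injective z) (hz0 : ∀ l, z l ≠ 0) {α β : Fin L → ℂ}
    (h : ∀ k < M, ∑ l, (α l * z l ^ k + β l * (k * z l ^ k)) = 0) : α = 0 ∧ β = 0 := by
  classical
  -- The factor `z l` in front of the derivative turns the monomial of degree `k` into `k * z l ^
  -- k`.
  have key (p : Polynomial ℂ) (hp : p.natDegree < M) :
      ∑ l, (α l * p.eval (z l) + β l * (z l * p.derivative.eval (z l))) = 0 := by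
    have hmon (k : ℕ) (hk : k < M) (a : ℂ) : ∑ l, (α l * (Polynomial.monomial k a).eval (z l) +
        β l * (z l * (Polynomial.monomial k a).derivative.eval (z l))) = 0 := by
      rw [← mul_zero a, ← h k hk, Finset.mul_sum]
      refine Finset.sum_congr rfl fun l _ => ?_
      rw [Polynomial.derivative_monomial, Polynomial.eval_monomial, Polynomial.eval_monomial]
      rcases k with _ | k
      · simp; ring
      · rw [Nat.add_sub_cancel, pow_succ]; ring
    rw [p.as_sum_range' M hp]
    simp only [Polynomial.derivative_sum, Polynomial.eval_finsetSum, Finset.mul_sum,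
      ← Finset.sum_add_distrib]
    rw [Finset.sum_comm]
    exact Finset.sum_eq_zero fun k hk => hmon k (Finset.mem_range.1 hk) _
  -- `Q r` has a double zero at every node except `z r`, so only the index `r` survives in the
  -- functional.
  set Q : Fin L → Polynomial ℂ := fun r =>
    ∏ l ∈ Finset.univ.erase r, (Polynomial.X - Polynomial.C (z l)) ^ 2 with hQ
  have hdeg (r : Fin L) : (Q r).natDegree ≤ 2 * (L - 1) := by
    refine (Polynomial.natDegree_prod_le _ _).trans ?_
    refine (Finset.sum_le_card_nsmul _ _ 2 fun l _ => ?_).trans ?_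
    · refine (Polynomial.natDegree_pow_le).trans ?_
      rw [Polynomial.natDegree_X_sub_C]
    · rw [Finset.card_erase_of_mem (Finset.mem_univ r), Finset.card_univ, Fintype.card_fin,
        smul_eq_mul, mul_comm]
  have hfac (r l : Fin L) (hl : l ≠ r) : ∃ S, Q r = (Polynomial.X - Polynomial.C (z l)) ^ 2 * S :=
    Finset.dvd_prod_of_mem _ (Finset.mem_erase.2 ⟨hl, Finset.mem_univ l⟩)
  have hQ0 (r l : Fin L) (hl : l ≠ r) : (Q r).eval (z l) = 0 := by
    obtain ⟨S, hS⟩ := hfac r l hl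
    simp [hS]
  have hQ1 (r l : Fin L) (hl : l ≠ r) : (Q r).derivative.eval (z l) = 0 := by
    obtain ⟨S, hS⟩ := hfac r l hl
    simp [hS, Polynomial.derivative_mul, Polynomial.derivative_pow]
  have hQr (r : Fin L) : (Q r).eval (z r) ≠ 0 := by
    simp only [hQ, Polynomial.eval_prod, Polynomial.eval_pow, Polynomial.eval_sub,
      Polynomial.eval_X, Polynomial.eval_C]
    refine Finset.prod_ne_zero_iff.2 fun l hl => pow_ne_zero 2 (sub_ne_zero.2 fun e => ?_)
    exact (Finset.mem_erase.1 hl).1 (hz e).symm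
  have hβ : β = 0 := by
    ext r
    have hL : 0 < L := r.pos
    -- The extra simple zero at `z r` removes the value there and leaves the derivative. The degree
    -- is at most `2 * L - 1`, which uses `2 * L ≤ M` fully.
    have h1 := key ((Polynomial.X - Polynomial.C (z r)) * Q r) (by
      refine lt_of_le_of_lt Polynomial.natDegree_mul_le ?_
      rw [Polynomial.natDegree_X_sub_C]
      have := hdeg r
      omega)
    rw [Finset.sum_eq_single r] at h1
    · simpa [Polynomial.derivative_mul, hz0 r, hQr r] using h1
    · intro l _ hl
      simp [Polynomial.derivative_mul, hQ0 r l hl, hQ1 r l hl]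
    · simp
  refine ⟨?_, hβ⟩
  ext r
  have hL : 0 < L := r.pos
  have h1 := key (Q r) (by have := hdeg r; omega)
  rw [Finset.sum_eq_single r] at h1
  · simpa [hβ, hQr r] using h1
  · intro l _ hl
    simp [hQ0 r l hl, hβ]
  · simp

/-- Each column of a kernel relation is a confluent Vandermonde system. It kills the amplitude
velocities, and a nonzero entry of `b l` then kills the velocity of the frequency `l`. -/
theorem columnDifferential_injective {M K L : ℕ} (hLM : 2 * L ≤ M) {θ : Fin L → ℝ}
    (hθ : Function.Injective fun l => expNode (θ l)) {b : Fin L → Fin K → ℂ} (hb : ∀ l, b l ≠ 0) :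
    Function.Injective (columnDifferential M θ b) := by
  rw [← LinearMap.ker_eq_bot, LinearMap.ker_eq_bot']
  intro p hp
  have h (j : Fin K) := eq_zero_of_sum_confluent_pow_eq_zero hLM hθ
    (fun l => expNode_ne_zero (θ l)) (α := fun l => star (p.1 l j))
    (β := fun l => -(Complex.I * 2 * Real.pi) * p.2 l * star (b l j)) (by
      intro k hk
      have h1 := congrFun (congrFun hp ⟨k, hk⟩) j
      refine Eq.trans (Finset.sum_congr rfl fun l _ => ?_) h1
      rw [expSeqDeriv, expSeq_eq_pow]
      ring)
  refine Prod.ext ?_ ?_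
  · ext l j
    simpa using congrFun (h j).1 l
  · ext l
    obtain ⟨j, hj⟩ := Function.ne_iff.1 (hb l)
    have := congrFun (h j).2 l
    simp only [Pi.zero_apply, mul_eq_zero, neg_eq_zero, star_eq_zero] at this hj
    simpa [hj, Real.pi_ne_zero] using this

theorem finrank_pi_complex (K L : ℕ) : Module.finrank ℝ (Fin L → Fin K → ℂ) = 2 * (L * K) := by
  simp [Module.finrank_pi_fintype, Complex.finrank_real_complex]
  ring

theorem finrank_span_tangentVectors_of_nondegenerate {M K L : ℕ} (hLM : 2 * L ≤ M)
    {θ : Fin L → ℝ} (hθ : Function.Injective fun l => expNode (θ l)) {b : Fin L → Fin K → ℂ}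
    (hb : ∀ l, b l ≠ 0) :
    L * (1 + 2 * K) ≤ Module.finrank ℝ (Submodule.span ℝ (tangentVectors (columnMMV M K L)
      (∑ l, Matrix.vecMulVec (expSeq M (θ l)) (star (b l))))) := by
  have h1 := LinearMap.finrank_range_of_inj (columnDifferential_injective hLM hθ hb)
  rw [Module.finrank_prod, finrank_pi_complex, Module.finrank_pi, Fintype.card_fin] at h1
  have h2 : LinearMap.range (columnDifferential M θ b) ≤ Submodule.span ℝ (tangentVectors
      (columnMMV M K L) (∑ l, Matrix.vecMulVec (expSeq M (θ l)) (star (b l)))) := by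
    rintro _ ⟨p, rfl⟩
    exact Submodule.subset_span (columnDifferential_mem_tangentVectors M θ b p)
  refine le_trans (le_of_eq ?_) (Submodule.finrank_mono h2)
  rw [h1]
  ring

/-- A path of zero amplitude can be given any frequency `φ` without changing the matrix; its
amplitude is then switched on. -/
theorem vecMulVec_mem_tangentVectors_of_eq_zero (M : ℕ) {K L : ℕ} (θ : Fin L → ℝ)
    {b : Fin L → Fin K → ℂ} {r : Fin L} (hr : b r = 0) (φ : ℝ) (u : Fin K → ℂ) :
    Matrix.vecMulVec (expSeq M φ) (star u) ∈ tangentVectors (columnMMV M K L)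
      (∑ l, Matrix.vecMulVec (expSeq M (θ l)) (star (b l))) := by
  have h := columnDifferential_mem_tangentVectors M (Function.update θ r φ) b
    (Pi.single r u, 0)
  have h1 : ∑ l, Matrix.vecMulVec (expSeq M (Function.update θ r φ l)) (star (b l)) =
      ∑ l, Matrix.vecMulVec (expSeq M (θ l)) (star (b l)) := by
    refine Finset.sum_congr rfl fun l _ => ?_
    by_cases hl : l = r
    · subst hl; ext i j; simp [hr, Matrix.vecMulVec_apply]
    · rw [Function.update_of_ne hl]
  have h2 : columnDifferential M (Function.update θ r φ) b (Pi.single r u, 0) =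
      Matrix.vecMulVec (expSeq M φ) (star u) := by
    ext i j
    simp only [columnDifferential, LinearMap.coe_mk, AddHom.coe_mk, Matrix.of_apply,
      Matrix.vecMulVec_apply]
    rw [Finset.sum_eq_single r]
    · simp
    · intro l _ hl
      simp [Pi.single_eq_of_ne hl]
    · simp
  rwa [h1, h2] at h

/-- The free path reaches all `M` exponentials at the roots of unity. By Vandermonde the span has
real dimension at least `2 * M * K ≥ 4 * L * K`. -/
theorem finrank_span_tangentVectors_of_degenerate {M K L : ℕ} (hLM : 2 * L ≤ M) (hK : 1 ≤ K)
    (θ : Fin L → ℝ) {b : Fin L → Fin K → ℂ} {r : Fin L} (hr : b r = 0) :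
    L * (1 + 2 * K) ≤ Module.finrank ℝ (Submodule.span ℝ (tangentVectors (columnMMV M K L)
      (∑ l, Matrix.vecMulVec (expSeq M (θ l)) (star (b l))))) := by
  have hL : 0 < L := r.pos
  let Ψ : (Fin M → Fin K → ℂ) →ₗ[ℝ] Matrix (Fin M) (Fin K) ℂ :=
    (columnDifferential M (fun k : Fin M => ((k : ℕ) / M : ℝ)) (0 : Fin M → Fin K → ℂ)).comp
      (LinearMap.inl ℝ _ _)
  have hΨ (u : Fin M → Fin K → ℂ) : Ψ u =
      ∑ k : Fin M, Matrix.vecMulVec (expSeq M ((k : ℕ) / M)) (star (u k)) := by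
    ext i j
    simp [Ψ, columnDifferential, Matrix.sum_apply, Matrix.vecMulVec_apply]
  have hinj : Function.Injective Ψ := by
    rw [← LinearMap.ker_eq_bot, LinearMap.ker_eq_bot']
    intro u hu
    have h (j : Fin K) := Matrix.eq_zero_of_forall_pow_sum_mul_pow_eq_zero
      (expNode_div_injective (M := M) (by omega)) (v := fun k => star (u k j)) (by
        intro i
        have h1 := congrFun (congrFun hu i) j
        rw [hΨ] at h1
        simpa [Matrix.sum_apply, Matrix.vecMulVec_apply, expSeq_eq_pow, mul_comm] using h1)
    ext k j
    simpa using congrFun (h j) k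
  have h1 := LinearMap.finrank_range_of_inj hinj
  rw [finrank_pi_complex] at h1
  have h2 : LinearMap.range Ψ ≤ Submodule.span ℝ (tangentVectors
      (columnMMV M K L) (∑ l, Matrix.vecMulVec (expSeq M (θ l)) (star (b l)))) := by
    rintro _ ⟨u, rfl⟩
    rw [hΨ]
    exact Submodule.sum_mem _ fun k _ => Submodule.subset_span
      (vecMulVec_mem_tangentVectors_of_eq_zero M θ hr _ _)
  refine le_trans ?_ (Submodule.finrank_mono h2)
  rw [h1]
  nlinarith [Nat.mul_le_mul_right K hLM, Nat.mul_le_mul_left L hK]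

theorem finrank_span_tangentVectors_columnMMV {M K L : ℕ} (hLM : 2 * L ≤ M) (hK : 1 ≤ K)
    {X : Matrix (Fin M) (Fin K) ℂ} (hX : X ∈ columnMMV M K L) :
    L * (1 + 2 * K) ≤
      Module.finrank ℝ (Submodule.span ℝ (tangentVectors (columnMMV M K L) X)) := by
  obtain ⟨θ, b, -, rfl⟩ := hX
  by_cases hb : ∀ l, b l ≠ 0
  · by_cases hθ : Function.Injective fun l => expNode (θ l)
    · exact finrank_span_tangentVectors_of_nondegenerate hLM hθ hb
    · simp only [Function.Injective, not_forall] at hθ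
      obtain ⟨r, s, hrs, hne⟩ := hθ
      -- Equal nodes allow the amplitude of `r` to be moved onto `s`; this fixes the matrix and
      -- reduces to a vanishing amplitude.
      let b' : Fin L → Fin K → ℂ := b + Pi.single s (b r) - Pi.single r (b r)
      have hr : b' r = 0 := by simp [b', Pi.single_eq_of_ne hne]
      have h1 : ∑ l, Matrix.vecMulVec (expSeq M (θ l)) (star (b' l)) =
          ∑ l, Matrix.vecMulVec (expSeq M (θ l)) (star (b l)) := by
        have h2 (q : Fin L) : ∑ l, Matrix.vecMulVec (expSeq M (θ l))
            (star ((Pi.single q (b r) : Fin L → Fin K → ℂ) l)) =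
            Matrix.vecMulVec (expSeq M (θ q)) (star (b r)) := by
          rw [Finset.sum_eq_single q]
          · simp
          · intro l _ hl
            ext i j
            simp [Pi.single_eq_of_ne hl, Matrix.vecMulVec_apply]
          · simp
        simp only [b', Pi.add_apply, Pi.sub_apply, star_add, star_sub, Matrix.vecMulVec_add,
          Matrix.vecMulVec_sub, Finset.sum_add_distrib, Finset.sum_sub_distrib, h2]
        rw [expSeq_congr hrs]
        abel
      rw [← h1]
      exact finrank_span_tangentVectors_of_degenerate hLM hK θ hr
  · push Not at hb
    obtain ⟨r, hr⟩ := hb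
    exact finrank_span_tangentVectors_of_degenerate hLM hK θ hr

/-! ### Averages over random samples -/

theorem nonempty_sampleSet {K k : ℕ} (h : k ≤ K) : Nonempty (SampleSet K k) := by
  obtain ⟨s, -, hs⟩ := Finset.exists_subset_card_eq (s := (Finset.univ : Finset (Fin K))) (n := k)
    (by simpa using h)
  exact ⟨⟨s, hs⟩⟩

/-- Double counting: each index lies in `(K - 1).choose (k - 1)` of the sets. -/
theorem sum_sampleSet {K k : ℕ} (hk : 1 ≤ k) (f : Fin K → ℝ) :
    (K : ℝ) * ∑ A : SampleSet K k, ∑ i ∈ A.1, f i =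
      k * Fintype.card (SampleSet K k) * ∑ i, f i := by
  have h1 : ∑ A : SampleSet K k, ∑ i ∈ A.1, f i =
      ∑ A ∈ (Finset.univ : Finset (Fin K)).powersetCard k, ∑ i ∈ A, f i :=
    (Finset.sum_subtype _ (by simp) fun A => ∑ i ∈ A, f i).symm
  have h2 : ∑ A ∈ (Finset.univ : Finset (Fin K)).powersetCard k, ∑ i ∈ A, f i =
      ∑ i, ∑ A ∈ (Finset.univ : Finset (Fin K)).powersetCard k with i ∈ A, f i :=
    Finset.sum_comm' (by simp)
  have h3 (i : Fin K) : ((Finset.univ : Finset (Fin K)).powersetCard k |>.filter (i ∈ ·)).card =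
      (K - 1).choose (k - 1) := by
    have := Finset.card_filter_powersetCard_subset {i} (Finset.univ : Finset (Fin K)) k
    simpa [hk] using this
  rw [h1, h2]
  simp only [Finset.sum_const, h3, nsmul_eq_mul, Fintype.card_finset_len, Fintype.card_fin]
  rw [← Finset.mul_sum, ← mul_assoc]
  congr 1
  rcases K with _ | K
  · rcases k with _ | k
    · omega
    · simp
  · obtain ⟨k, rfl⟩ := Nat.exists_eq_add_of_le' hk
    have := Nat.add_one_mul_choose_eq K k
    rw [mul_comm ((k + 1 : ℕ) : ℝ)]
    exact_mod_cast this

theorem downsample_mul_apply {K k n : ℕ} (A : SampleSet K k) (X : Matrix (Fin K) (Fin n) ℂ)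
    (i : Fin k) (j : Fin n) : (downsample A * X) i j = X (A.1.orderEmbOfFin A.2 i) j := by
  simp [Matrix.mul_apply, downsample]

theorem frobSq_downsample_mul {K k n : ℕ} (A : SampleSet K k) (X : Matrix (Fin K) (Fin n) ℂ) :
    frobSq (downsample A * X) = ∑ i ∈ A.1, ∑ j, ‖X i j‖ ^ 2 := by
  conv_rhs => rw [← Finset.image_orderEmbOfFin_univ A.1 A.2]
  rw [Finset.sum_image fun i _ j _ h => (A.1.orderEmbOfFin A.2).injective h]
  simp only [frobSq, downsample_mul_apply]

/-- Provides the averaging hypothesis of `cramerRao_random_sampling` with `ρ = k / K`. -/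
theorem average_frobSq_downsample_mul {K k n : ℕ} (hk : 1 ≤ k) (hkK : k ≤ K)
    (X : Matrix (Fin K) (Fin n) ℂ) :
    (Fintype.card (SampleSet K k) : ℝ)⁻¹ * ∑ A : SampleSet K k, frobSq (downsample A * X) =
      k / K * frobSq X := by
  have := nonempty_sampleSet hkK
  have h := sum_sampleSet hk fun i => ∑ j, ‖X i j‖ ^ 2
  have hc : (Fintype.card (SampleSet K k) : ℝ) ≠ 0 := Nat.cast_ne_zero.2 Fintype.card_ne_zero
  have hK : (K : ℝ) ≠ 0 := Nat.cast_ne_zero.2 (by omega)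
  simp only [frobSq_downsample_mul]
  rw [frobSq]
  field_simp
  linarith

theorem frobSq_transpose {m n : ℕ} (X : Matrix (Fin m) (Fin n) ℂ) : frobSq Xᵀ = frobSq X := by
  simp only [frobSq, Matrix.transpose_apply]
  exact Finset.sum_comm

theorem average_frobSq_mul_downsample_transpose {K k m : ℕ} (hk : 1 ≤ k) (hkK : k ≤ K)
    (X : Matrix (Fin m) (Fin K) ℂ) :
    (Fintype.card (SampleSet K k) : ℝ)⁻¹ * ∑ P : SampleSet K k, frobSq (X * (downsample P)ᵀ) =
      k / K * frobSq X := by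
  rw [← frobSq_transpose X, ← average_frobSq_downsample_mul hk hkK]
  congr 1
  refine Finset.sum_congr rfl fun P _ => ?_
  rw [← frobSq_transpose, Matrix.transpose_mul, Matrix.transpose_transpose]

/-! ### From columns to rows by conjugate transposition -/

theorem conjTranspose_mem_rowMMV {M N L : ℕ} {X : Matrix (Fin N) (Fin M) ℂ}
    (hX : X ∈ columnMMV N M L) : Xᴴ ∈ rowMMV M N L := by
  obtain ⟨τ, b, hτ, rfl⟩ := hX
  refine ⟨τ, b, hτ, ?_⟩
  rw [Matrix.conjTranspose_sum]
  simp [Matrix.conjTranspose_vecMulVec]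

theorem conjTranspose_mem_columnMMV {M N L : ℕ} {X : Matrix (Fin M) (Fin N) ℂ}
    (hX : X ∈ rowMMV M N L) : Xᴴ ∈ columnMMV N M L := by
  obtain ⟨τ, b, hτ, rfl⟩ := hX
  refine ⟨τ, b, hτ, ?_⟩
  rw [Matrix.conjTranspose_sum]
  simp [Matrix.conjTranspose_vecMulVec]

/-- Conjugate transposition is a real-linear equivalence that exchanges the two models and carries
curves to curves. -/
theorem finrank_span_tangentVectors_rowMMV {M N L : ℕ} (hLN : 2 * L ≤ N) (hM : 1 ≤ M)
    {X : Matrix (Fin M) (Fin N) ℂ} (hX : X ∈ rowMMV M N L) :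
    L * (1 + 2 * M) ≤ Module.finrank ℝ (Submodule.span ℝ (tangentVectors (rowMMV M N L) X)) := by
  let e := Matrix.conjTransposeLinearEquiv (Fin N) (Fin M) ℝ ℂ
  refine (finrank_span_tangentVectors_columnMMV hLN hM (conjTranspose_mem_columnMMV hX)).trans ?_
  rw [← e.finrank_map_eq, Submodule.map_span]
  refine Submodule.finrank_mono (Submodule.span_mono ?_)
  rintro _ ⟨D, ⟨γ, h0, hγ, hD⟩, rfl⟩
  refine ⟨fun t => (γ t)ᴴ, by simp [h0], fun t => conjTranspose_mem_rowMMV (hγ t), fun i j => ?_⟩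
  exact (hD j i).star

theorem channel_mem_rowMMV (M N : ℕ) {L : ℕ} (c : Fin L → ℂ) (θ : Fin L → ℝ) {τ : Fin L → ℝ}
    (hτ : ∀ l, τ l ∈ Set.Icc (0 : ℝ) 1) : channel M N c θ τ ∈ rowMMV M N L :=
  ⟨τ, fun l => c l • expSeq M (θ l), hτ, by simp only [channel, Matrix.smul_vecMulVec]⟩

theorem channel_mul_mem_columnMMV (M N : ℕ) {L K : ℕ} (c : Fin L → ℂ) {θ : Fin L → ℝ}
    (τ : Fin L → ℝ) (hθ : ∀ l, θ l ∈ Set.Icc (0 : ℝ) 1) (B : Matrix (Fin N) (Fin K) ℂ) :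
    channel M N c θ τ * B ∈ columnMMV M K L := by
  refine ⟨θ, fun l => star (c l • (star (expSeq N (τ l)) ᵥ* B)), hθ, ?_⟩
  simp only [channel, Matrix.sum_mul, Matrix.smul_mul, Matrix.vecMulVec_mul, star_star,
    Matrix.vecMulVec_smul]

/-! ### The two estimation steps -/

theorem ENNReal.le_average {α : Type*} [Fintype α] [Nonempty α] {f : α → ℝ≥0∞} {b : ℝ≥0∞}
    (h : ∀ a, b ≤ f a) : b ≤ (Fintype.card α : ℝ≥0∞)⁻¹ * ∑ a, f a := by
  calc b = (Fintype.card α : ℝ≥0∞)⁻¹ * ∑ _a : α, b := by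
        rw [Finset.sum_const, Finset.card_univ, nsmul_eq_mul, ← mul_assoc,
          ENNReal.inv_mul_cancel (by simp) (by simp), one_mul]
    _ ≤ _ := by gcongr; exact h _

/-- Unbiasedness holds for each pilot set separately, so the Cramér–Rao bound over antenna sets
applies to each and is then averaged. -/
theorem ofReal_le_firstStepMSE {M N L Mp Np : ℕ} {σ : ℝ} (hσ : σ ≠ 0) (hLM : 2 * L ≤ M)
    (hMp : 1 ≤ Mp) (hMpM : Mp ≤ M) (hNp : 1 ≤ Np) (hNpN : Np ≤ N) (c : Fin L → ℂ)
    {θ : Fin L → ℝ} (τ : Fin L → ℝ) (hθ : ∀ l, θ l ∈ Set.Icc (0 : ℝ) 1)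
    {est : SampleSet M Mp → SampleSet N Np → Matrix (Fin Mp) (Fin Np) ℂ →
      Matrix (Fin M) (Fin Np) ℂ} (hest : FirstStepUnbiased L σ est) :
    ENNReal.ofReal (L * (1 + 2 * Np) * σ ^ 2 / (2 * Mp * Np)) ≤
      firstStepMSE σ est (channel M N c θ τ) := by
  have := nonempty_sampleSet hMpM
  have := nonempty_sampleSet hNpN
  have hM : (0 : ℝ) < M := Nat.cast_pos.2 (by omega)
  have hMp' : (0 : ℝ) < Mp := Nat.cast_pos.2 hMp
  have hNp' : (0 : ℝ) < Np := Nat.cast_pos.2 hNp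
  have hv : (σ ^ 2).toNNReal ≠ 0 := (Real.toNNReal_pos.2 (by positivity)).ne'
  have hP (P : SampleSet N Np) := cramerRao_random_sampling hv
    (fun A : SampleSet M Mp =>
      { toFun := fun X : Matrix (Fin M) (Fin Np) ℂ => downsample A * X
        map_add' := Matrix.mul_add _
        map_smul' := fun r X => Matrix.mul_smul _ r X : _ →ₗ[ℝ] _ })
    (ρ := Mp / M) (by positivity) (average_frobSq_downsample_mul hMp hMpM)
    (fun A => est A P) (columnMMV M Np L) (hest P)
    (channel_mul_mem_columnMMV M N c τ hθ (downsample P)ᵀ)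
  rw [Real.coe_toNNReal _ (sq_nonneg σ)] at hP
  have hdim (P : SampleSet N Np) := (Nat.cast_le (α := ℝ)).2
    (finrank_span_tangentVectors_columnMMV hLM hNp
      (channel_mul_mem_columnMMV M N c τ hθ (downsample P)ᵀ))
  push_cast at hdim
  have hmean := ENNReal.le_average fun P => (ENNReal.ofReal_le_ofReal
    (mul_le_mul_of_nonneg_right (hdim P) (by positivity : 0 ≤ σ ^ 2 / (2 * ((Mp : ℝ) / M))))).trans
      (hP P)
  have e : (L : ℝ) * (1 + 2 * Np) * σ ^ 2 / (2 * Mp * Np) =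
      ((M : ℝ) * Np)⁻¹ * (L * (1 + 2 * Np) * (σ ^ 2 / (2 * ((Mp : ℝ) / M)))) := by
    field_simp
  rw [e, ENNReal.ofReal_mul (by positivity), ENNReal.ofReal_inv_of_pos (by positivity),
    ENNReal.ofReal_mul hM.le, ENNReal.ofReal_natCast, ENNReal.ofReal_natCast, firstStepMSE]
  simp only [LinearMap.coe_mk, AddHom.coe_mk, ← Matrix.mul_assoc] at hmean
  gcongr

/-- Here the pilot set itself is the random sample, with `ρ = Np / N`. -/
theorem ofReal_le_secondStepMSE {M N L Np : ℕ} {v : ℝ≥0} (hv : v ≠ 0) (hLN : 2 * L ≤ N)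
    (hM : 1 ≤ M) (hNp : 1 ≤ Np) (hNpN : Np ≤ N) {H : Matrix (Fin M) (Fin N) ℂ}
    (hH : H ∈ rowMMV M N L)
    {est : SampleSet N Np → Matrix (Fin M) (Fin Np) ℂ → Matrix (Fin M) (Fin N) ℂ}
    (hest : SecondStepUnbiased L v est) :
    ENNReal.ofReal (L * (1 + 2 * M) * v / (2 * M * Np)) ≤ secondStepMSE v est H := by
  have := nonempty_sampleSet hNpN
  have hN : (0 : ℝ) < N := Nat.cast_pos.2 (by omega)
  have hM' : (0 : ℝ) < M := Nat.cast_pos.2 hM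
  have hNp' : (0 : ℝ) < Np := Nat.cast_pos.2 hNp
  have h := cramerRao_random_sampling hv
    (fun P : SampleSet N Np =>
      { toFun := fun X : Matrix (Fin M) (Fin N) ℂ => X * (downsample P)ᵀ
        map_add' := fun X Y => Matrix.add_mul X Y _
        map_smul' := fun r X => Matrix.smul_mul r X _ : _ →ₗ[ℝ] _ })
    (ρ := Np / N) (by positivity) (average_frobSq_mul_downsample_transpose hNp hNpN)
    est (rowMMV M N L) hest hH
  have hdim := (Nat.cast_le (α := ℝ)).2 (finrank_span_tangentVectors_rowMMV hLN hM hH)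
  push_cast at hdim
  have hmean := (ENNReal.ofReal_le_ofReal (mul_le_mul_of_nonneg_right hdim
    (by positivity : 0 ≤ (v : ℝ) / (2 * ((Np : ℝ) / N))))).trans h
  have e : (L : ℝ) * (1 + 2 * M) * v / (2 * M * Np) =
      ((M : ℝ) * N)⁻¹ * (L * (1 + 2 * M) * (v / (2 * ((Np : ℝ) / N)))) := by
    field_simp
  rw [e, ENNReal.ofReal_mul (by positivity), ENNReal.ofReal_inv_of_pos (by positivity),
    ENNReal.ofReal_mul hM'.le, ENNReal.ofReal_natCast, ENNReal.ofReal_natCast, secondStepMSE]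
  simp only [LinearMap.coe_mk, AddHom.coe_mk] at hmean
  gcongr

/-- The relative difference is exactly `1/(2 Np) + 1/(2 M) + 1/(4 Np M)`, and each term is at most
`ε / 4`. -/
theorem abs_mmvBound_sub_mmvApprox_le {ε : ℝ} (L : ℕ) {M Mp Np : ℕ} (σ : ℝ) (hM : 1 ≤ M)
    (hNp : 1 ≤ Np) (hεM : 2 ≤ ε * M) (hεN : 2 ≤ ε * Np) :
    |mmvBound L M Mp Np σ - mmvApprox L Mp Np σ| ≤ ε * mmvApprox L Mp Np σ := by
  have hM' : (1 : ℝ) ≤ M := Nat.one_le_cast.2 hM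
  have hNp' : (1 : ℝ) ≤ Np := Nat.one_le_cast.2 hNp
  have hA : 0 ≤ mmvApprox L Mp Np σ := by unfold mmvApprox; positivity
  have e : mmvBound L M Mp Np σ - mmvApprox L Mp Np σ =
      (1 / (2 * (Np : ℝ)) + 1 / (2 * M) + 1 / (4 * Np * M)) * mmvApprox L Mp Np σ := by
    -- For `Mp = 0` both expressions are `0` by the convention for division by zero.
    rcases Nat.eq_zero_or_pos Mp with rfl | hMp
    · simp [mmvBound, mmvApprox]
    · have : (0 : ℝ) < Mp := Nat.cast_pos.2 hMp
      rw [mmvBound, mmvApprox]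
      field_simp
      ring
  rw [e, abs_of_nonneg (by positivity)]
  refine mul_le_mul_of_nonneg_right ?_ hA
  have h1 : 1 / (2 * (Np : ℝ)) ≤ ε / 4 := by
    rw [div_le_iff₀ (by positivity)]
    linarith
  have h2 : 1 / (2 * (M : ℝ)) ≤ ε / 4 := by
    rw [div_le_iff₀ (by positivity)]
    linarith
  have h3 : 1 / (4 * (Np : ℝ) * M) ≤ 1 / (2 * Np) := by
    refine one_div_le_one_div_of_le (by positivity) ?_
    nlinarith
  have hε : 0 ≤ ε / 4 := le_trans (by positivity) h1
  linarith

theorem proposition1 :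
    -- the bound on the per-element mean squared error
    (∀ (M N L Mp Np : ℕ) (σ : ℝ), 2 * L ≤ M → 2 * L ≤ N → 1 ≤ Mp → Mp ≤ M → 1 ≤ Np → Np ≤ N →
      ∀ (c : Fin L → ℂ) (θ τ : Fin L → ℝ),
      (∀ l, θ l ∈ Set.Icc (0 : ℝ) 1) → (∀ l, τ l ∈ Set.Icc (0 : ℝ) 1) →
      -- a first-step estimator from the noisy observations, with per-element error variance `v`
      ∀ (est₁ : SampleSet M Mp → SampleSet N Np → Matrix (Fin Mp) (Fin Np) ℂ →
          Matrix (Fin M) (Fin Np) ℂ) (v : ℝ≥0),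
      FirstStepUnbiased L σ est₁ →
      firstStepMSE σ est₁ (channel M N c θ τ) = v →
      -- a second-step estimator, the first-step error being i.i.d. Gaussian of variance `v`
      ∀ est₂ : SampleSet N Np → Matrix (Fin M) (Fin Np) ℂ → Matrix (Fin M) (Fin N) ℂ,
      SecondStepUnbiased L v est₂ →
      ENNReal.ofReal (mmvBound L M Mp Np σ) ≤ secondStepMSE v est₂ (channel M N c θ τ)) ∧
    -- the bound is asymptotically equivalent to its simplified form
    (∀ ε : ℝ, 0 < ε → ∃ K : ℕ, ∀ (L M Mp Np : ℕ) (σ : ℝ), K ≤ Mp → Mp ≤ M → K ≤ Np →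
      |mmvBound L M Mp Np σ - mmvApprox L Mp Np σ| ≤ ε * mmvApprox L Mp Np σ) := by
  constructor
  · intro M N L Mp Np σ hLM hLN hMp hMpM hNp hNpN c θ τ hθ hτ est₁ v hest₁ hv est₂ hest₂
    rcases eq_or_ne σ 0 with rfl | hσ
    · simp [mmvBound]
    rcases Nat.eq_zero_or_pos L with rfl | hL
    · simp [mmvBound]
    have hM' : (0 : ℝ) < M := Nat.cast_pos.2 (by omega)
    have hMp' : (0 : ℝ) < Mp := Nat.cast_pos.2 hMp
    have hNp' : (0 : ℝ) < Np := Nat.cast_pos.2 hNp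
    have hL' : (0 : ℝ) < L := Nat.cast_pos.2 hL
    have h1 := ofReal_le_firstStepMSE hσ hLM hMp hMpM hNp hNpN c τ hθ hest₁
    rw [hv, ← ENNReal.ofReal_coe_nnreal, ENNReal.ofReal_le_ofReal_iff v.coe_nonneg] at h1
    -- With `σ` and `L` nonzero the first-step bound is positive; the second step needs `v ≠ 0` for
    -- its Gaussian density.
    have hv0 : v ≠ 0 := by
      have : (0 : ℝ) < v := lt_of_lt_of_le (by positivity) h1
      exact_mod_cast this.ne'
    refine le_trans (ENNReal.ofReal_le_ofReal ?_) (ofReal_le_secondStepMSE hv0 hLN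
      (hMp.trans hMpM) hNp hNpN (channel_mem_rowMMV M N c θ hτ) hest₂)
    -- The claimed bound is the second-step bound with `v` replaced by the first-step bound.
    calc mmvBound L M Mp Np σ = L * (1 + 2 * M) / (2 * M * Np) *
          (L * (1 + 2 * Np) * σ ^ 2 / (2 * Mp * Np)) := by
          rw [mmvBound]; field_simp; ring
      _ ≤ L * (1 + 2 * M) / (2 * M * Np) * v := by gcongr
      _ = L * (1 + 2 * M) * v / (2 * M * Np) := by ring
  · intro ε hε
    obtain ⟨K, hK⟩ := exists_nat_ge (2 / ε)
    -- The added `1` guarantees that `M` and `Np` are positive.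
    refine ⟨K + 1, fun L M Mp Np σ hMp hMpM hNp => ?_⟩
    have h1 (n : ℕ) (hn : K + 1 ≤ n) : 2 ≤ ε * n := by
      rw [← div_le_iff₀' hε]
      exact hK.trans (Nat.cast_le.2 (by omega))
    exact abs_mmvBound_sub_mmvApprox_le L σ (by omega) (by omega) (h1 M (hMp.trans hMpM))
      (h1 Np hNp)
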